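/- For a positive integer $k$, the $k$-path power with layout $\langle x_1,\dots,x_n\rangle$ is the graph on $\{x_1,\dots,x_n\}$ in which $x_i$ and $x_j$, $i\neq j$, are adjacent if and only if $|i-j|\le k$. The linear clique-width $\mathrm{lcwd}(G)$ of a finite graph $G$ is the least number of labels with which $G$ can be built, starting from the empty graph, by the following operations: adding a single new vertex with a label, as a disjoint union; adding all edges between the vertices of label $i$ and the vertices of label $j$, where $i\neq j$; changing every label $i$ into $j$. The gem is the path on four vertices together with one further vertex adjacent to all four. Let $M^-_2$ be the disjoint union of two gems, and let $M^+_2$ be obtained from $M^-_2$ by adding one edge that joins a vertex of degree $2$ of one gem to a vertex of degree $2$ of the other gem. For integers $k\ge 3$ and $l\ge 0$, let $M_{k,1,l}$ be obtained from the disjoint union of two $k$-path powers, each on $n=k^2$ vertices, with layouts $\langle v_1,\dots,v_n\rangle$ and $\langle v'_1,\dots,v'_n\rangle$, and of $l$ new vertices $w_1,\dots,w_l$, by adding the edges of the path $v_n,w_1,\dots,w_l,v'_n$ (of length $l+1$). Then the following hold. 1. Every proper induced subgraph of $M^+_2$ and every proper induced subgraph of $M^-_2$ has linear clique-width at most $3$.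 2. For all $k\ge 3$ and $l\ge 0$, every proper induced subgraph of $M_{k,1,l}$ has linear clique-width at most $k+1$. 3. These graphs are minimal forbidden induced subgraphs: $\mathrm{lcwd}(M^+_2)>3$ and $\mathrm{lcwd}(M^-_2)>3$, so that $M^+_2$ and $M^-_2$ are minimal forbidden induced subgraphs for the graphs of linear clique-width at most $3$; and $\mathrm{lcwd}(M_{k,1,l})>k+1$ for all $k\ge 3$ and $l\ge 0$, so that $M_{k,1,l}$ is a minimal forbidden induced subgraph for the graphs of linear clique-width at most $k+1$. -/

import Mathlib

namespace LinCW

/-- The labelled graphs that are values of linear `k`-expressions, with vertices taken from `V`.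
`LinearExpr k S H lab` says that some linear `k`-expression has as its value the labelled graph
with vertex set `S`, with edges those of `H` (none of which leaves `S`), and with the label `lab v`
at every vertex `v` of `S`; the values of `lab` outside `S` are irrelevant.
The operations are: the empty graph; the disjoint union with a single new labelled vertex; the
addition of all edges between the vertices of label `i` and those of label `j`, where `i ≠ j`;
the change of every label `i` into the label `j`. -/
inductive LinearExpr {V : Type*} (k : ℕ) : Set V → SimpleGraph V → (V → Fin k) → Prop
  | empty (lab : V → Fin k) : LinearExpr k ∅ ⊥ lab
  | addVertex {S : Set V} {H : SimpleGraph V} {lab : V → Fin k} (v : V) (lab' : V → Fin k) :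
      LinearExpr k S H lab → v ∉ S → (∀ u ∈ S, lab' u = lab u) →
      LinearExpr k (insert v S) H lab'
  | join {S : Set V} {H : SimpleGraph V} {lab : V → Fin k} (i j : Fin k) :
      LinearExpr k S H lab → i ≠ j →
      LinearExpr k S
        (H ⊔ SimpleGraph.fromRel fun u w => u ∈ S ∧ w ∈ S ∧ lab u = i ∧ lab w = j) lab
  | relabel {S : Set V} {H : SimpleGraph V} {lab : V → Fin k} (i j : Fin k) :
      LinearExpr k S H lab →
      LinearExpr k S H (fun u => if lab u = i then j else lab u)

/-- `G` has a linear `k`-expression. -/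
def HasLinearExpr {V : Type*} (k : ℕ) (G : SimpleGraph V) : Prop :=
  ∃ lab : V → Fin k, LinearExpr k Set.univ G lab

/-- The linear clique-width of `G`: the least `k` such that `G` has a linear `k`-expression. -/
noncomputable def lcwd {V : Type*} (G : SimpleGraph V) : ℕ∞ :=
  sInf {m : ℕ∞ | ∃ k : ℕ, m = (k : ℕ∞) ∧ HasLinearExpr k G}

/-- The `k`-path power on `n` vertices: distinct vertices are adjacent if and only if their
positions in the layout differ by at most `k`. -/
def pathPower (k n : ℕ) : SimpleGraph (Fin n) where
  Adj i j := i ≠ j ∧ i.val ≤ j.val + k ∧ j.val ≤ i.val + k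
  symm := ⟨fun _ _ h => ⟨h.1.symm, h.2.2, h.2.1⟩⟩
  loopless := ⟨fun _ h => h.1 rfl⟩

/-- The gem: the induced path `0, 1, 2, 3` together with the vertex `4`, which is adjacent to all
vertices of the path. -/
def gem : SimpleGraph (Fin 5) :=
  SimpleGraph.fromRel fun i j => (i.val + 1 = j.val ∧ j.val < 4) ∨ j.val = 4

/-- The disjoint union of two gems. -/
def MMinusTwo : SimpleGraph (Fin 5 ⊕ Fin 5) := SimpleGraph.sum gem gem

/-- Two disjoint gems together with one edge, which joins an end of the path of one gem and an end
of the path of the other gem. -/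
def MPlusTwo : SimpleGraph (Fin 5 ⊕ Fin 5) :=
  MMinusTwo ⊔ SimpleGraph.edge (Sum.inl 3) (Sum.inr 3)

/-- The edges by which the path `w_1, ..., w_l` is put between the last vertices `v_n` and `v'_n`
of two layouts with `n` vertices each: the edge `v_n v'_n` if `l = 0`, and the edges `v_n w_1` and
`w_l v'_n` if `l ≥ 1`. -/
def linkRel (n l : ℕ) : Fin n ⊕ (Fin n ⊕ Fin l) → Fin n ⊕ (Fin n ⊕ Fin l) → Prop
  | Sum.inl i, Sum.inr (Sum.inl j) => l = 0 ∧ i.val + 1 = n ∧ j.val + 1 = n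
  | Sum.inl i, Sum.inr (Sum.inr t) => i.val + 1 = n ∧ t.val = 0
  | Sum.inr (Sum.inl j), Sum.inr (Sum.inr t) => j.val + 1 = n ∧ t.val + 1 = l
  | _, _ => False

/-- `M_{k,1,l}`: two disjoint `k`-path powers on `k ^ 2` vertices each, whose last vertices are
joined by an induced path of length `l + 1` with `l` new inner vertices. -/
def MGraph (k l : ℕ) : SimpleGraph (Fin (k ^ 2) ⊕ (Fin (k ^ 2) ⊕ Fin l)) :=
  SimpleGraph.sum (pathPower k (k ^ 2)) (SimpleGraph.sum (pathPower k (k ^ 2)) (pathPower 1 l)) ⊔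
    SimpleGraph.fromRel (linkRel (k ^ 2) l)

end LinCW

/-!
Upper bound. Add the vertices one by one. If, before each addition, the vertices present form at
most `k` groups whose members have the same neighbours among the vertices still to come, then one
label for each group and one for the new vertex suffice. Once a vertex is removed, such an order
exists: cut the path power that has lost it into rows of length `k`, with the missing vertex in the
first column, fill the rows from the last one upwards below the diagonal, and then go on column by
column from the right; the missing vertex is what saves a group when the first column is crossed.
A path power that has lost no vertex is filled in the same way around its last vertex, which is
added, followed by a part of the linking path, once the last column is complete; in the end at most
one of these vertices has neighbours still to come, and it takes a single group.

Lower bound. Consider the order in which a linear expression adds the vertices, and the addition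
of a vertex `x` that cannot share the label of a vertex present. It takes a label for `x` and one
for each of any vertices present that have pairwise different neighbourhoods among the vertices
still to come. In a path power, let `x` be the vertex that reaches the last residue class of
positions modulo `k`: then `k - 1` vertices present have different neighbourhoods in the path power
itself. In the path power that comes to this point second, there are two further such vertices
outside, in the other path power or on the linking path, of which at least one still lacks a
neighbour. This makes `k + 2` labels. In the same way a gem needs three labels at some addition,
and the gem that comes to this point second needs a fourth one for a vertex of the other gem.
-/

namespace LinCW

section LinearExpressions

variable {V W : Type*} {k : ℕ} {G : SimpleGraph V} {S T : Set V} {H : SimpleGraph V}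
  {lab : V → Fin k}

theorem LinearExpr.mem_of_adj (h : LinearExpr k S H lab) {u w : V} (huw : H.Adj u w) :
    u ∈ S ∧ w ∈ S := by
  induction h with
  | empty _ => simp at huw
  | addVertex _ _ _ _ _ ih => exact ⟨Or.inr (ih huw).1, Or.inr (ih huw).2⟩
  | join i j _ _ ih =>
    rcases huw with huw | huw
    · exact ih huw
    · rw [SimpleGraph.fromRel_adj] at huw
      rcases huw.2 with h | h
      · exact ⟨h.1, h.2.1⟩
      · exact ⟨h.2.1, h.1⟩
  | relabel _ _ _ ih => exact ih huw

theorem comap_sup_fromRel (f : W ↪ V) (H : SimpleGraph V) (r : V → V → Prop) :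
    (H ⊔ SimpleGraph.fromRel r).comap f =
      H.comap f ⊔ SimpleGraph.fromRel fun u w => r (f u) (f w) := by
  ext u w
  simp only [SimpleGraph.comap_adj, SimpleGraph.sup_adj, SimpleGraph.fromRel_adj, ne_eq,
    f.injective.eq_iff]

theorem LinearExpr.comap (f : W ↪ V) (h : LinearExpr k S H lab) :
    ∃ lab' : W → Fin k, LinearExpr k (f ⁻¹' S) (H.comap f) lab' ∧
      ∀ w, f w ∈ S → lab' w = lab (f w) := by
  induction h with
  | empty lab =>
    refine ⟨lab ∘ f, ?_, fun _ h => h.elim⟩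
    rw [Set.preimage_empty, SimpleGraph.comap_bot]
    exact LinearExpr.empty _
  | @addVertex S H lab v lab' _ hv hlab ih =>
    obtain ⟨l, hl, hl'⟩ := ih
    by_cases hw : ∃ w, f w = v
    · obtain ⟨w, rfl⟩ := hw
      have hpre : f ⁻¹' (insert (f w) S) = insert w (f ⁻¹' S) := by ext x; simp
      rw [hpre]
      exact ⟨lab' ∘ f, LinearExpr.addVertex w _ hl hv fun u hu => (hlab _ hu).trans (hl' u hu).symm,
        fun _ _ => rfl⟩
    · have hpre : f ⁻¹' (insert v S) = f ⁻¹' S := by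
        ext x
        simpa using fun h : f x = v => (hw ⟨x, h⟩).elim
      rw [hpre]
      refine ⟨l, hl, ?_⟩
      rintro w (h | h)
      · exact (hw ⟨w, h⟩).elim
      · rw [hl' w h, hlab _ h]
  | @join S H lab i j _ hij ih =>
    obtain ⟨l, hl, hl'⟩ := ih
    refine ⟨l, ?_, hl'⟩
    rw [comap_sup_fromRel]
    convert LinearExpr.join i j hl hij using 5 with u w
    simp only [Set.mem_preimage]
    refine and_congr_right fun hu => and_congr_right fun hw => ?_
    rw [hl' u hu, hl' w hw]
  | relabel i j _ ih =>
    obtain ⟨l, hl, hl'⟩ := ih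
    refine ⟨_, LinearExpr.relabel i j hl, fun w hw => ?_⟩
    simp only [hl' w hw]

theorem LinearExpr.joinAll (h : LinearExpr k S H lab) (f : Fin k) (s : Finset (Fin k))
    (hf : f ∉ s) :
    LinearExpr k S
      (H ⊔ SimpleGraph.fromRel fun u w => u ∈ S ∧ w ∈ S ∧ lab u ∈ s ∧ lab w = f) lab := by
  induction s using Finset.induction_on with
  | empty =>
    convert h using 1
    ext u w
    simp
  | @insert a s _ ih =>
    rw [Finset.mem_insert, not_or] at hf
    convert LinearExpr.join a f (ih hf.2) (Ne.symm hf.1) using 1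
    ext u w
    simp only [SimpleGraph.sup_adj, SimpleGraph.fromRel_adj, Finset.mem_insert]
    tauto

theorem LinearExpr.mapLabels (h : LinearExpr k S H lab) (φ : Fin k → Fin k)
    (hφ : ∀ a, φ (φ a) = φ a) : LinearExpr k S H fun v => φ (lab v) := by
  have map_on : ∀ s : Finset (Fin k),
      LinearExpr k S H fun v => if lab v ∈ s then φ (lab v) else lab v := by
    intro s
    induction s using Finset.induction_on with
    | empty => simpa using h
    | @insert a s ha ih =>
      convert LinearExpr.relabel a (φ a) ih using 1
      funext v
      by_cases h1 : lab v ∈ s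
      · simp only [h1, Finset.mem_insert, or_true, if_true]
        split_ifs with h2
        · rw [← h2, hφ]
        · rfl
      · by_cases h2 : lab v = a
        · simp [h2, ha]
        · simp [h1, h2]
  simpa using map_on Finset.univ

theorem LinearExpr.exists_label_eq_iff (h : LinearExpr k S H lab) (r : Setoid V)
    (hr : ∀ y ∈ S, ∀ z ∈ S, lab y = lab z → r y z) :
    ∃ lab' : V → Fin k, LinearExpr k S H lab' ∧
      ∀ y ∈ S, ∀ z ∈ S, (lab' y = lab' z ↔ r y z) := by
  classical
  let r' : Setoid S := r.comap Subtype.val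
  let ρ : S → S := fun y => (Quotient.mk r' y).out
  have rel_ρ : ∀ y, r (ρ y) y := fun y => Quotient.mk_out (s := r') y
  have ρ_congr : ∀ y z : S, r y z → ρ y = ρ z := fun y z hyz => by
    have : Quotient.mk r' y = Quotient.mk r' z := Quotient.sound hyz
    simp only [ρ, this]
  let φ : Fin k → Fin k := fun a =>
    if ha : ∃ y : S, lab y = a then lab (ρ ha.choose) else a
  have φ_lab : ∀ y : S, φ (lab y) = lab (ρ y) := fun y => by
    have ha : ∃ y' : S, lab y' = lab y := ⟨y, rfl⟩
    simp only [φ, dif_pos ha]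
    rw [ρ_congr _ _ (hr _ ha.choose.2 _ y.2 ha.choose_spec)]
  have φ_idem : ∀ a, φ (φ a) = φ a := by
    intro a
    by_cases ha : ∃ y : S, lab y = a
    · obtain ⟨y, rfl⟩ := ha
      rw [φ_lab, φ_lab, ρ_congr _ _ (rel_ρ y)]
    · have : φ a = a := dif_neg ha
      rw [this, this]
  refine ⟨_, h.mapLabels φ φ_idem, fun y hy z hz => ?_⟩
  rw [φ_lab ⟨y, hy⟩, φ_lab ⟨z, hz⟩]
  refine ⟨fun hyz => ?_, fun hyz => by rw [ρ_congr ⟨y, hy⟩ ⟨z, hz⟩ hyz]⟩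
  have hρ := hr _ (ρ ⟨y, hy⟩).2 _ (ρ ⟨z, hz⟩).2 hyz
  exact r.trans (r.symm (rel_ρ ⟨y, hy⟩)) (r.trans hρ (rel_ρ ⟨z, hz⟩))

/-- The edges of `G` between vertices of `T`, as a graph on all vertices of `G`. -/
def restrict (G : SimpleGraph V) (T : Set V) : SimpleGraph V where
  Adj u w := G.Adj u w ∧ u ∈ T ∧ w ∈ T
  symm := ⟨fun _ _ h => ⟨h.1.symm, h.2.2, h.2.1⟩⟩
  loopless := ⟨fun _ h => h.1.ne rfl⟩

theorem restrict_insert {x : V} :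
    restrict G (insert x T) =
      restrict G T ⊔ SimpleGraph.fromRel fun u w => (u ∈ T ∧ G.Adj u x) ∧ w = x := by
  ext u w
  have hxx : ¬ G.Adj x x := G.loopless.irrefl x
  have hadj : G.Adj u w ↔ G.Adj w u := G.adj_comm u w
  simp only [restrict, SimpleGraph.sup_adj, SimpleGraph.fromRel_adj, Set.mem_insert_iff]
  grind

/-- The equivalence relation of having the same neighbours in `U`. -/
def sameTrace (G : SimpleGraph V) (U : Set V) : Setoid V where
  r y z := ∀ u ∈ U, G.Adj y u ↔ G.Adj z u
  iseqv := ⟨fun _ _ _ => Iff.rfl, fun h u hu => (h u hu).symm,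
    fun h h' u hu => (h u hu).trans (h' u hu)⟩

theorem LinearExpr.insert_restrict (h : LinearExpr k T (restrict G T) lab) {x : V} (hxT : x ∉ T)
    (f : Fin k) (hf : ∀ y ∈ T, lab y ≠ f)
    (hlab : ∀ y ∈ T, ∀ z ∈ T, lab y = lab z → G.Adj y x → G.Adj z x) :
    ∃ lab' : V → Fin k, LinearExpr k (insert x T) (restrict G (insert x T)) lab' ∧
      lab' x = f ∧ ∀ y ∈ T, lab' y = lab y := by
  classical
  let lab' := Function.update lab x f
  have lab'_of_mem : ∀ y ∈ T, lab' y = lab y := fun y hy =>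
    Function.update_of_ne (ne_of_mem_of_not_mem hy hxT) _ _
  have lab'_self : lab' x = f := Function.update_self _ _ _
  let s : Finset (Fin k) := Finset.univ.filter fun a => ∃ y ∈ T, lab y = a ∧ G.Adj y x
  have mem_s : ∀ a, a ∈ s ↔ ∃ y ∈ T, lab y = a ∧ G.Adj y x := by simp [s]
  have hfs : f ∉ s := fun hfs => by
    obtain ⟨y, hy, hyf, -⟩ := (mem_s f).1 hfs
    exact hf y hy hyf
  refine ⟨lab', ?_, lab'_self, lab'_of_mem⟩
  rw [restrict_insert]
  convert (h.addVertex x lab' hxT lab'_of_mem).joinAll f s hfs using 5 with u w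
  have hu : u ∈ insert x T ∧ lab' u ∈ s ↔ u ∈ T ∧ G.Adj u x := by
    constructor
    · rintro ⟨rfl | hu, hus⟩
      · exact (hfs (lab'_self ▸ hus)).elim
      · obtain ⟨y, hy, hyu, hyx⟩ := (mem_s _).1 hus
        exact ⟨hu, hlab y hy u hu (hyu.trans (lab'_of_mem u hu)) hyx⟩
    · rintro ⟨hu, hux⟩
      exact ⟨Or.inr hu, (mem_s _).2 ⟨u, hu, (lab'_of_mem u hu).symm, hux⟩⟩
  have hw : w ∈ insert x T ∧ lab' w = f ↔ w = x := by
    constructor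
    · rintro ⟨rfl | hw, hwf⟩
      · rfl
      · exact (hf w hw ((lab'_of_mem w hw).symm.trans hwf)).elim
    · rintro rfl
      exact ⟨Or.inl rfl, lab'_self⟩
  rw [← hu, ← hw]
  tauto

theorem lcwd_le (h : HasLinearExpr k G) : lcwd G ≤ k :=
  sInf_le ⟨k, rfl, h⟩

theorem exists_hasLinearExpr_of_lcwd_le (h : lcwd G ≤ k) : ∃ m ≤ k, HasLinearExpr m G := by
  have hlt : lcwd G < ((k + 1 : ℕ) : ℕ∞) := h.trans_lt (ENat.natCast_lt_natCast.2 k.lt_succ_self)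
  obtain ⟨_, ⟨m, rfl, hm⟩, hlt⟩ := sInf_lt_iff.1 hlt
  exact ⟨m, Nat.lt_succ_iff.1 (by exact_mod_cast hlt), hm⟩

end LinearExpressions

section NarrowPrefix

variable {V : Type*} {k : ℕ} {G : SimpleGraph V} {W S T : Set V}

/-- The vertices of `T` can be divided into `k` groups, the members of each of which have the same
neighbours in `W \ T`. -/
def FewGroups (k : ℕ) (G : SimpleGraph V) (W T : Set V) : Prop :=
  ∃ c : V → ℕ, (∀ y ∈ T, c y < k) ∧
    ∀ y ∈ T, ∀ z ∈ T, c y = c z → ∀ u ∈ W, u ∉ T → G.Adj y u → G.Adj z u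

/-- The vertices of `T` can be added one by one in such a way that, before each addition, the
vertices present form at most `k` groups with respect to the rest of `W`. -/
inductive NarrowPrefix (k : ℕ) (G : SimpleGraph V) (W : Set V) : Set V → Prop
  | empty : NarrowPrefix k G W ∅
  | add {T : Set V} {x : V} :
      NarrowPrefix k G W T → FewGroups k G W T → x ∈ W → NarrowPrefix k G W (insert x T)

theorem sameTrace_of_color_eq {c : V → ℕ}
    (hc : ∀ y ∈ T, ∀ z ∈ T, c y = c z → ∀ u ∈ W, u ∉ T → G.Adj y u → G.Adj z u)
    {y z : V} (hy : y ∈ T) (hz : z ∈ T) (hyz : c y = c z) : sameTrace G (W \ T) y z :=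
  fun u hu => ⟨hc y hy z hz hyz u hu.1 hu.2, hc z hz y hy hyz.symm u hu.1 hu.2⟩

theorem FewGroups.exists_label_ne (h : FewGroups k G W T) {lab : V → Fin (k + 1)}
    (hlab : ∀ y ∈ T, ∀ z ∈ T, sameTrace G (W \ T) y z → lab y = lab z) :
    ∃ f, ∀ y ∈ T, lab y ≠ f := by
  obtain ⟨c, hck, hc⟩ := h
  by_contra! hall
  choose g hgT hg using hall
  obtain ⟨a, b, hab, heq⟩ := Fintype.exists_ne_map_eq_of_card_lt
    (fun a => (⟨c (g a), hck _ (hgT a)⟩ : Fin k)) (by simp)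
  apply hab
  rw [← hg a, ← hg b]
  exact hlab _ (hgT a) _ (hgT b)
    (sameTrace_of_color_eq hc (hgT a) (hgT b) (by simpa using heq))

theorem NarrowPrefix.exists_linearExpr (h : NarrowPrefix k G W T) :
    ∃ lab : V → Fin (k + 1), LinearExpr (k + 1) T (restrict G T) lab ∧
      ∀ y ∈ T, ∀ z ∈ T, (lab y = lab z ↔ sameTrace G (W \ T) y z) := by
  induction h with
  | empty =>
    refine ⟨fun _ => 0, ?_, fun _ h => h.elim⟩
    convert LinearExpr.empty (V := V) (k := k + 1) (fun _ => 0) using 1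
    ext u w
    simp [restrict]
  | @add T x _ hfew hx ih =>
    obtain ⟨lab, hexpr, hlab⟩ := ih
    by_cases hxT : x ∈ T
    · rw [Set.insert_eq_of_mem hxT]
      exact ⟨lab, hexpr, hlab⟩
    obtain ⟨f, hf⟩ := hfew.exists_label_ne fun y hy z hz => (hlab y hy z hz).2
    obtain ⟨lab', hexpr', hx', hT'⟩ := hexpr.insert_restrict hxT f hf
      fun y hy z hz hyz => ((hlab y hy z hz).1 hyz x ⟨hx, hxT⟩).1
    refine hexpr'.exists_label_eq_iff (sameTrace G (W \ insert x T)) ?_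
    rintro y (rfl | hy) z (rfl | hz) hyz
    · exact (sameTrace _ _).refl _
    · exact (hf z hz (by rw [← hT' z hz, ← hyz, hx'])).elim
    · exact (hf y hy (by rw [← hT' y hy, hyz, hx'])).elim
    · rw [hT' y hy, hT' z hz] at hyz
      exact fun u hu => (hlab y hy z hz).1 hyz u ⟨hu.1, fun h => hu.2 (Or.inr h)⟩

theorem NarrowPrefix.hasLinearExpr (h : NarrowPrefix k G W W) (hS : S ⊆ W) :
    HasLinearExpr (k + 1) (G.induce S) := by
  obtain ⟨lab, hexpr, -⟩ := h.exists_linearExpr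
  obtain ⟨lab', hexpr', -⟩ := hexpr.comap (Function.Embedding.subtype (· ∈ S))
  refine ⟨lab', ?_⟩
  convert hexpr' using 1
  · ext v
    simpa using hS v.2
  · ext u w
    simp [restrict, hS u.2, hS w.2]

theorem NarrowPrefix.subset (h : NarrowPrefix k G W T) : T ⊆ W := by
  induction h with
  | empty => exact Set.empty_subset _
  | add _ _ hx ih => exact Set.insert_subset hx ih

end NarrowPrefix

section ConstructionOrder

variable {V : Type*} {k : ℕ} {G H : SimpleGraph V} {S : Set V} {lab lab' : V → Fin k}
  {τ τ' : V → ℕ} {v x : V} {c : V → Fin k}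

/-- If `τ` is the order in which the vertices are added, the new vertex `x` may be added with the
label of the vertex `y` added before. -/
def Shares (G : SimpleGraph V) (τ : V → ℕ) (x y : V) : Prop :=
  τ y < τ x ∧ ¬ G.Adj x y ∧ (∀ z, G.Adj x z → G.Adj y z) ∧
    ∀ z, τ x < τ z → G.Adj y z → G.Adj x z

/-- The vertices `a` and `b` must have distinct labels when `x` is added: they have different
neighbours among the vertices that are not yet present. -/
def Distinguished (G : SimpleGraph V) (τ : V → ℕ) (x a b : V) : Prop :=
  ∃ u, τ x ≤ τ u ∧ ¬ (G.Adj a u ↔ G.Adj b u)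

/-- A linear `k`-expression adds the vertices in an order with this property. It refers only to the
vertices `x` that cannot share the label of a vertex present, and bounds the number of labels in
use when `x` is added. -/
def NarrowOrder (G : SimpleGraph V) (τ : V → ℕ) (k : ℕ) : Prop :=
  ∀ x, (∀ y, ¬ Shares G τ x y) → ∀ A : Finset V, (∀ a ∈ A, τ a < τ x) →
    (∀ a ∈ A, ∀ b ∈ A, a ≠ b → Distinguished G τ x a b) → A.card + 1 ≤ k

/-- The colouring `c` records the labels in use just after `x` has been added, in the construction
of the labelled graph `H` in the order `τ`. -/
structure IsLabelSnapshot (S : Set V) (H : SimpleGraph V) (lab : V → Fin k) (τ : V → ℕ) (x : V)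
    (c : V → Fin k) : Prop where
  early : ∀ y ∈ S, ∀ z ∈ S, τ y < τ x → τ z < τ x → c y = c z →
    lab y = lab z ∧ ∀ u ∈ S, τ x ≤ τ u → (H.Adj y u ↔ H.Adj z u)
  self : ∀ y ∈ S, τ y < τ x → c y = c x → lab y = lab x ∧ Shares H τ x y

theorem IsLabelSnapshot.addVertex_self (hH : ∀ u w, H.Adj u w → u ∈ S ∧ w ∈ S) (hv : v ∉ S)
    (hτ : ∀ u ∈ S, τ u < τ v) : IsLabelSnapshot (insert v S) H lab τ v lab := by
  constructor
  · intro y _ z _ _ _ hyz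
    refine ⟨hyz, ?_⟩
    rintro u (rfl | hu) hvu
    · exact iff_of_false (fun h => hv (hH _ _ h).2) (fun h => hv (hH _ _ h).2)
    · exact absurd (hτ u hu) (not_lt.2 hvu)
  · intro y _ hyv hyx
    refine ⟨hyx, hyv, fun h => hv (hH _ _ h).1, fun z h => (hv (hH _ _ h).1).elim, ?_⟩
    exact fun z hz h => absurd (hτ z (hH _ _ h).2) (not_lt.2 hz.le)

theorem IsLabelSnapshot.addVertex (h : IsLabelSnapshot S H lab τ x c)
    (hH : ∀ u w, H.Adj u w → u ∈ S ∧ w ∈ S) (hv : v ∉ S) (hx : x ∈ S)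
    (hlab : ∀ u ∈ S, lab' u = lab u) (hτ : ∀ u ∈ S, τ' u = τ u) (hlt : τ' x < τ' v) :
    IsLabelSnapshot (insert v S) H lab' τ' x c := by
  have mem_of_lt : ∀ y ∈ insert v S, τ' y < τ' x → y ∈ S ∧ τ y < τ x := by
    rintro y (rfl | hy) hyx
    · exact absurd hyx hlt.not_gt
    · rw [hτ y hy, hτ x hx] at hyx
      exact ⟨hy, hyx⟩
  constructor
  · intro y hy z hz hyx hzx hyz
    obtain ⟨hy, hyx⟩ := mem_of_lt y hy hyx
    obtain ⟨hz, hzx⟩ := mem_of_lt z hz hzx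
    obtain ⟨hsame, hadj⟩ := h.early y hy z hz hyx hzx hyz
    refine ⟨by rw [hlab y hy, hlab z hz, hsame], ?_⟩
    rintro u (rfl | hu) hxu
    · exact iff_of_false (fun h => hv (hH _ _ h).2) (fun h => hv (hH _ _ h).2)
    · rw [hτ x hx, hτ u hu] at hxu
      exact hadj u hu hxu
  · intro y hy hyx hcyx
    obtain ⟨hyS, hyx'⟩ := mem_of_lt y hy hyx
    obtain ⟨hsame, -, hnadj, hsub, hsup⟩ := h.self y hyS hyx' hcyx
    refine ⟨by rw [hlab y hyS, hlab x hx, hsame], hyx, hnadj, hsub, fun z hz hadj => ?_⟩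
    rw [hτ x hx, hτ z (hH _ _ hadj).2] at hz
    exact hsup z hz hadj

theorem IsLabelSnapshot.join (h : IsLabelSnapshot S H lab τ x c) (hx : x ∈ S) {i j : Fin k}
    (hij : i ≠ j) :
    IsLabelSnapshot S
      (H ⊔ SimpleGraph.fromRel fun u w => u ∈ S ∧ w ∈ S ∧ lab u = i ∧ lab w = j) lab τ x c := by
  have adj_mono : ∀ y ∈ S, ∀ z ∈ S, lab y = lab z → ∀ u, u ≠ z → (H.Adj y u → H.Adj z u) →
      (H ⊔ SimpleGraph.fromRel fun u w => u ∈ S ∧ w ∈ S ∧ lab u = i ∧ lab w = j).Adj y u →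
      (H ⊔ SimpleGraph.fromRel fun u w => u ∈ S ∧ w ∈ S ∧ lab u = i ∧ lab w = j).Adj z u := by
    simp only [SimpleGraph.sup_adj, SimpleGraph.fromRel_adj]
    grind
  have not_adj_of_lab_eq : ∀ y z, lab y = lab z → ¬ H.Adj y z →
      ¬ (H ⊔ SimpleGraph.fromRel fun u w => u ∈ S ∧ w ∈ S ∧ lab u = i ∧ lab w = j).Adj y z := by
    simp only [SimpleGraph.sup_adj, SimpleGraph.fromRel_adj]
    grind
  constructor
  · intro y hy z hz hyx hzx hyz
    obtain ⟨hlab, hadj⟩ := h.early y hy z hz hyx hzx hyz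
    refine ⟨hlab, fun u hu hxu => ?_⟩
    have hne : ∀ w, τ w < τ x → u ≠ w := fun w hw => by rintro rfl; omega
    exact ⟨adj_mono y hy z hz hlab u (hne z hzx) (hadj u hu hxu).1,
      adj_mono z hz y hy hlab.symm u (hne y hyx) (hadj u hu hxu).2⟩
  · intro y hy hyx hcyx
    obtain ⟨hlab, -, hnadj, hsub, hsup⟩ := h.self y hy hyx hcyx
    have hnadj' := not_adj_of_lab_eq x y hlab.symm hnadj
    refine ⟨hlab, hyx, hnadj', fun z hz => adj_mono x hx y hy hlab.symm z ?_ (hsub z) hz,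
      fun z hz => adj_mono y hy x hx hlab z ?_ (hsup z hz)⟩
    · rintro rfl; exact hnadj' hz
    · rintro rfl; omega

theorem IsLabelSnapshot.relabel (h : IsLabelSnapshot S H lab τ x c) (i j : Fin k) :
    IsLabelSnapshot S H (fun u => if lab u = i then j else lab u) τ x c where
  early y hy z hz hyx hzx hyz := by
    obtain ⟨hlab, hadj⟩ := h.early y hy z hz hyx hzx hyz
    exact ⟨by simp only [hlab], hadj⟩
  self y hy hyx hcyx := by
    obtain ⟨hlab, hshares⟩ := h.self y hy hyx hcyx
    exact ⟨by simp only [hlab], hshares⟩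

theorem LinearExpr.exists_labelSnapshot (h : LinearExpr k S H lab) :
    ∃ τ : V → ℕ, S.InjOn τ ∧ (∃ N, ∀ v ∈ S, τ v < N) ∧
      ∀ x ∈ S, ∃ c : V → Fin k, IsLabelSnapshot S H lab τ x c := by
  classical
  induction h with
  | empty lab => exact ⟨fun _ => 0, by simp, ⟨0, by simp⟩, fun _ h => h.elim⟩
  | @addVertex S H lab v lab' hS hv hlab ih =>
    obtain ⟨τ, hinj, ⟨N, hN⟩, hc⟩ := ih
    let τ' := Function.update τ v N
    have hτv : τ' v = N := Function.update_self _ _ _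
    have hτ : ∀ u ∈ S, τ' u = τ u := fun u hu =>
      Function.update_of_ne (ne_of_mem_of_not_mem hu hv) _ _
    have hlt : ∀ u ∈ S, τ' u < τ' v := fun u hu => by rw [hτ u hu, hτv]; exact hN u hu
    have hH : ∀ u w, H.Adj u w → u ∈ S ∧ w ∈ S := fun u w h => hS.mem_of_adj h
    refine ⟨τ', (Set.injOn_insert hv).2 ⟨hinj.congr fun u hu => (hτ u hu).symm, ?_⟩,
      ⟨N + 1, ?_⟩, ?_⟩
    · rintro ⟨u, hu, huv⟩
      exact (hlt u hu).ne huv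
    · rintro y (rfl | hy)
      · omega
      · exact (hlt y hy).trans (by omega)
    · rintro x (rfl | hx)
      · exact ⟨lab', IsLabelSnapshot.addVertex_self hH hv hlt⟩
      · obtain ⟨c, hc⟩ := hc x hx
        exact ⟨c, hc.addVertex hH hv hx hlab hτ (hlt x hx)⟩
  | join i j _ hij ih =>
    obtain ⟨τ, hinj, hN, hc⟩ := ih
    refine ⟨τ, hinj, hN, fun x hx => ?_⟩
    obtain ⟨c, hc⟩ := hc x hx
    exact ⟨c, hc.join hx hij⟩
  | relabel i j _ ih =>
    obtain ⟨τ, hinj, hN, hc⟩ := ih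
    refine ⟨τ, hinj, hN, fun x hx => ?_⟩
    obtain ⟨c, hc⟩ := hc x hx
    exact ⟨c, hc.relabel i j⟩

theorem HasLinearExpr.exists_narrowOrder (h : HasLinearExpr k G) :
    ∃ τ : V → ℕ, Function.Injective τ ∧ NarrowOrder G τ k := by
  classical
  obtain ⟨lab, h⟩ := h
  obtain ⟨τ, hinj, -, hc⟩ := h.exists_labelSnapshot
  refine ⟨τ, Set.injOn_univ.1 hinj, fun x hx A hA hdist => ?_⟩
  obtain ⟨c, hc⟩ := hc x trivial
  have hxA : x ∉ A := fun h => lt_irrefl _ (hA x h)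
  have hcx : ∀ y ∈ A, c y ≠ c x := fun y hy hyx =>
    hx y (hc.self y trivial (hA y hy) hyx).2
  have hcA : Set.InjOn c A := fun a ha b hb hab => by
    by_contra hne
    obtain ⟨u, hu, hn⟩ := hdist a ha b hb hne
    exact hn ((hc.early a trivial b trivial (hA a ha) (hA b hb) hab).2 u trivial hu)
  have hcinj : Set.InjOn c (insert x A : Finset V) := by
    rw [Finset.coe_insert, Set.injOn_insert (by exact_mod_cast hxA)]
    exact ⟨hcA, by rintro ⟨y, hy, hyx⟩; exact hcx y hy hyx⟩
  have hcard := Finset.card_le_card_of_injOn (t := Finset.univ) c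
    (fun _ _ => Finset.mem_univ _) hcinj
  rwa [Finset.card_insert_of_notMem hxA, Finset.card_univ, Fintype.card_fin] at hcard

theorem exists_narrowOrder_of_lcwd_le (h : lcwd G ≤ k) :
    ∃ τ : V → ℕ, Function.Injective τ ∧ NarrowOrder G τ k := by
  obtain ⟨m, hm, hG⟩ := exists_hasLinearExpr_of_lcwd_le h
  obtain ⟨τ, hτ, hnarrow⟩ := hG.exists_narrowOrder
  exact ⟨τ, hτ, fun x hx A hA hAA => (hnarrow x hx A hA hAA).trans hm⟩

theorem Distinguished.symm {a b : V} (h : Distinguished G τ x a b) : Distinguished G τ x b a :=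
  h.imp fun _ hu => ⟨hu.1, fun hba => hu.2 hba.symm⟩

theorem Distinguished.ne {a b : V} (h : Distinguished G τ x a b) : a ≠ b := by
  rintro rfl
  obtain ⟨u, -, hu⟩ := h
  exact hu Iff.rfl

end ConstructionOrder

section Cells

variable {k q a₀ a j x y : ℕ} {X M : ℕ → ℕ → Prop} {c : ℕ → ℕ → ℕ} {δ : ℕ}

/-- A path power on `k ^ 2` vertices is cut into rows of length `k`, the first of which lacks its
first `k - q` cells; position `p` is the cell `p + k - q` of the numbering row by row. `IsCell`
says that row `a` has a cell in column `j`. -/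
def IsCell (k q a j : ℕ) : Prop := a ≤ k ∧ j < k ∧ (a = 0 → k ≤ j + q) ∧ (a = k → j + q < k)

/-- The adjacency of distinct cells `(a, j)` and `(a', j')` of a path power. -/
def NearCell (a j a' j' : ℕ) : Prop := a = a' ∨ a' = a + 1 ∧ j' ≤ j ∨ a = a' + 1 ∧ j ≤ j'

/-- A division into `k` groups of the cells in `X` with respect to the cells that are neither in
`X` nor in `M`. The cells in the group `δ` have no neighbours among the latter. -/
structure IsCellColoring (k q : ℕ) (M X : ℕ → ℕ → Prop) (c : ℕ → ℕ → ℕ) (δ : ℕ) : Prop where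
  dead_lt : δ < k
  lt : ∀ a j, IsCell k q a j → X a j → c a j < k
  near : ∀ a j a' j', IsCell k q a j → IsCell k q a' j' → X a j → X a' j' → c a j = c a' j' →
    ∀ x y, IsCell k q x y → ¬ X x y → ¬ M x y → NearCell a j x y → NearCell a' j' x y
  dead : ∀ a j, IsCell k q a j → X a j → c a j = δ →
    ∀ x y, IsCell k q x y → ¬ X x y → ¬ M x y → ¬ NearCell a j x y

theorem IsCellColoring.of_near_iff (f : ℕ → ℕ → ℕ → Prop) (dead_lt : δ < k)
    (lt : ∀ a j, IsCell k q a j → X a j → c a j < k)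
    (near_iff : ∀ a j, IsCell k q a j → X a j → ∀ x y, IsCell k q x y → ¬ X x y → ¬ M x y →
      (NearCell a j x y ↔ f (c a j) x y))
    (dead : ∀ a j, IsCell k q a j → X a j → c a j = δ →
      ∀ x y, IsCell k q x y → ¬ X x y → ¬ M x y → ¬ f δ x y) :
    IsCellColoring k q M X c δ where
  dead_lt := dead_lt
  lt := lt
  near a j a' j' ha ha' hX hX' hc x y hx hxX hxM := by
    rw [near_iff a j ha hX x y hx hxX hxM, near_iff a' j' ha' hX' x y hx hxX hxM, hc]
    exact id
  dead a j ha hX hc x y hx hxX hxM := by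
    rw [near_iff a j ha hX x y hx hxX hxM, hc]
    exact dead a j ha hX hc x y hx hxX hxM

/-- The cell `(a₀, 0)`, if it is not the last one. -/
def InnerGap (k q a₀ x y : ℕ) : Prop := x = a₀ ∧ y = 0 ∧ ¬ (a₀ = k ∧ q + 1 = k)

/-- The cells `(a, j)` with `1 ≤ j < a`, if the rows are filled from the last one upwards and from
the right, down to column `m` of row `h`. -/
def stairs (h m a j : ℕ) : Prop := (1 ≤ j ∧ j + 1 ≤ a) ∧ (h < a ∨ a = h ∧ m ≤ j)

/-- The rows that are complete have a group each. In the two rows that are being filled the groups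
are the columns. -/
def stairsColor (k q h m a j : ℕ) : ℕ :=
  if h + 2 ≤ a then a - 1 else if a = h + 1 then min j (max m 1)
    else if h = k ∨ h + 1 = k ∧ q + 1 = k then j else j + 1

theorem stairsColor_mem {h m : ℕ} (hc : IsCell k q a j) (hX : stairs h m a j) :
    1 ≤ stairsColor k q h m a j ∧ stairsColor k q h m a j < k ∧
      (q + 1 = k → stairsColor k q h m a j + 1 ≠ k) := by
  unfold IsCell stairs stairsColor at *
  split_ifs <;> omega

set_option maxHeartbeats 400000 in
-- The case distinctions leave some hundred goals to `omega`.
theorem isCellColoring_stairs (hk : 0 < k) (h m : ℕ) :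
    IsCellColoring k q M (stairs h m) (stairsColor k q h m) 0 where
  dead_lt := hk
  lt _ _ hc hX := (stairsColor_mem hc hX).2.1
  near a j a' j' ha ha' hX hX' hc x y hx hxX _ hn := by
    unfold IsCell stairs stairsColor NearCell at *
    obtain ⟨hX, hXh⟩ := hX
    obtain ⟨hX', hXh'⟩ := hX'
    rcases hXh with hXh | hXh <;> rcases hXh' with hXh' | hXh' <;>
      rcases hn with hn | hn | hn <;> split_ifs at hc <;> omega
  dead _ _ ha hX hc := by
    have := (stairsColor_mem ha hX).1
    omega

/-- The cells `(a, j)` with `1 ≤ j < a`, and the cells of column `0` strictly between the rows `a₀`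
and `t`. -/
def leftUpper (a₀ t a j : ℕ) : Prop := (1 ≤ j ∧ j + 1 ≤ a) ∨ (j = 0 ∧ a₀ < a ∧ a < t)

theorem isCellColoring_leftUpper (ha₀ : 1 ≤ a₀) (hk : 0 < k) (t : ℕ) :
    IsCellColoring k q (InnerGap k q a₀) (leftUpper a₀ t) (fun a _ => a - 1) 0 where
  dead_lt := hk
  lt a j ha _ := by unfold IsCell leftUpper at *; omega
  near a j a' j' ha ha' hX hX' hc x y hx hxX hxM hn := by
    unfold InnerGap IsCell leftUpper NearCell at *
    omega
  dead a j ha hX hc x y hx hxX hxM hn := by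
    unfold InnerGap IsCell leftUpper NearCell at *
    omega

/-- The cells below the diagonal, except those of column `0` that are not below the row `a₀`, and
the cells of the diagonal from row `h` on. -/
def diagonal (a₀ h a j : ℕ) : Prop :=
  (1 ≤ j ∧ j + 1 ≤ a) ∨ (j = 0 ∧ a₀ < a) ∨ (j = a ∧ 1 ≤ j ∧ h ≤ a)

/-- Above row `h` a group is a row; below it, a diagonal cell belongs to the group of the next row.
-/
def diagonalColor (k h a j : ℕ) : ℕ :=
  if a = k then (if h < k then 0 else k - 1) else if j = a ∨ h < a then a else a - 1

/-- The neighbours, among the cells that are not in `diagonal a₀ h`, of the cells in the group `c`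
of `diagonalColor`. -/
def diagonalTrace (h c x y : ℕ) : Prop :=
  c ≠ 0 ∧ if c < h then y = 0 ∧ (x = c + 1 ∨ x = c + 2) ∨ 1 ≤ y ∧ (x = c + 1 ∨ x = c)
    else y = 0 ∧ (x = c ∨ x = c + 1) ∨ 1 ≤ y ∧ (x = c ∨ x + 1 = c ∧ c ≤ y)

theorem isCellColoring_diagonal (ha₀ : 1 ≤ a₀) (ha₀k : a₀ ≤ k) (h : ℕ) :
    IsCellColoring k q (InnerGap k q a₀) (diagonal a₀ h) (diagonalColor k h) 0 := by
  refine IsCellColoring.of_near_iff (diagonalTrace h) (by omega) ?_ ?_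
    fun _ _ _ _ _ _ _ _ _ _ hf => hf.1 rfl
  · intro a j ha _
    unfold IsCell diagonalColor at *
    split_ifs <;> omega
  · intro a j ha hX x y hx hxX hxM
    unfold InnerGap IsCell diagonal diagonalTrace diagonalColor NearCell at *
    rcases hX with hX | hX | hX <;> split_ifs <;> omega

/-- The cells on or below the diagonal, except those of column `0` from row `t` to row `a₀`. -/
def leftLower (a₀ t a j : ℕ) : Prop :=
  (1 ≤ j ∧ j ≤ a) ∨ (j = 0 ∧ a₀ < a) ∨ (j = 0 ∧ a < a₀ ∧ a < t)

/-- The groups are the rows, shifted by one below the diagonal. -/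
def stripColor (a j : ℕ) : ℕ := if j ≤ a then a - 1 else a

theorem stripColor_lt (hc : IsCell k q a j) : stripColor a j < k := by
  unfold IsCell stripColor at *
  split_ifs <;> omega

theorem isCellColoring_leftLower (hk : 3 ≤ k) (hq : q < k) (ha₀ : a₀ ≤ k) (t : ℕ) :
    IsCellColoring k q (InnerGap k q a₀) (leftLower a₀ t) stripColor (k - 1) := by
  refine IsCellColoring.of_near_iff
    (fun c x y => x = c + 1 ∨ x = c ∧ 1 ≤ y ∨ x = c + 2 ∧ y = 0) (by omega)
    (fun a j ha _ => stripColor_lt ha) ?_ ?_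
  · intro a j ha hX x y hx hxX hxM
    unfold InnerGap IsCell leftLower stripColor NearCell at *
    rcases hX with hX | hX | hX <;> split_ifs <;> omega
  · intro a j ha hX hc x y hx hxX hxM
    unfold InnerGap IsCell leftLower stripColor at *
    split_ifs at hc <;> omega

/-- The cells on or below the diagonal other than `(a₀, 0)`, all cells to the right of column `m`,
and the cells of column `m` above row `t`. -/
def columns (a₀ m t a j : ℕ) : Prop :=
  (j ≤ a ∧ ¬ (a = a₀ ∧ j = 0)) ∨ (m < j ∧ a + 1 ≤ j) ∨ (j = m ∧ a + 1 ≤ m ∧ a < t)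

theorem isCellColoring_columns (hk : 3 ≤ k) (hq : q < k) (ha₀ : 1 ≤ a₀) (ha₀k : a₀ ≤ k)
    (m t : ℕ) :
    IsCellColoring k q (fun x y => x = a₀ ∧ y = 0) (columns a₀ m t) stripColor (k - 1) := by
  refine IsCellColoring.of_near_iff (fun c x _ => x = c ∨ x = c + 1) (by omega)
    (fun a j ha _ => stripColor_lt ha) ?_ ?_
  · intro a j ha hX x y hx hxX hxM
    unfold IsCell columns stripColor NearCell at *
    rcases hX with hX | hX | hX <;> split_ifs <;> omega
  · intro _ _ _ _ _ x y hx hxX hxM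
    unfold IsCell columns at *
    omega

/-- The variant of `stripColor` for the last column, if the last cell `(k, 0)` is still to be added.
The neighbours of the cell `(k - 2, k - 1)` are then all present. -/
def lastColor (k a j : ℕ) : ℕ := if a + 2 = k ∧ j + 1 = k then k - 1 else stripColor a j

theorem isCellColoring_lastColumn (hk : 3 ≤ k) (t : ℕ) :
    IsCellColoring k (k - 1) (fun _ _ => False) (columns k (k - 1) t) (lastColor k) (k - 1) := by
  refine IsCellColoring.of_near_iff (fun c x _ => c + 1 ≠ k ∧
    (x < k ∧ (x = c ∨ x = c + 1) ∨ x = k ∧ c + 2 = k)) (by omega) ?_ ?_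
    fun _ _ _ _ _ _ _ _ _ _ hf => by omega
  · intro a j ha _
    unfold lastColor stripColor IsCell at *
    split_ifs <;> omega
  · intro a j ha hX x y hx hxX _
    unfold IsCell columns lastColor stripColor NearCell at *
    rcases hX with hX | hX | hX <;> split_ifs <;> omega

/-- The variant of `stripColor` for the time after the addition of the last cell `(k, 0)`. It leaves
the group `k - 2` empty, as the last two rows have no neighbours that are still to be added. -/
def spareColor (k a j : ℕ) : ℕ :=
  if k ≤ a + 1 ∨ a + 2 = k ∧ j + 1 = k then k - 1 else stripColor a j

theorem spareColor_lt (hc : IsCell k q a j) : spareColor k a j < k := by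
  unfold IsCell spareColor stripColor at *
  split_ifs <;> omega

theorem spareColor_ne (hk : 3 ≤ k) (hc : IsCell k q a j) : spareColor k a j ≠ k - 2 := by
  unfold IsCell spareColor stripColor at *
  split_ifs <;> omega

theorem isCellColoring_spareColumns (hk : 3 ≤ k) {m : ℕ} (hm : m + 2 ≤ k) (t : ℕ) :
    IsCellColoring k (k - 1) (fun x y => x = k ∧ y = 0) (columns k m t) (spareColor k) (k - 1) := by
  refine IsCellColoring.of_near_iff (fun c x _ => c + 1 ≠ k ∧ (x = c ∨ x = c + 1)) (by omega)
    (fun a j ha _ => spareColor_lt ha) ?_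
    fun _ _ _ _ _ _ _ _ _ _ hf => by omega
  intro a j ha hX x y hx hxX hxM
  unfold IsCell columns spareColor stripColor NearCell at *
  rcases hX with hX | hX | hX <;> split_ifs <;> omega

end Cells

section Positions

variable {k q p p' a j : ℕ}

/-- The row of the position `p`, see `IsCell`. -/
def row (k q p : ℕ) : ℕ := (p + k - q) / k

/-- The column of the position `p`, see `IsCell`. -/
def col (k q p : ℕ) : ℕ := (p + k - q) % k

theorem mul_row_add_col (hq : q < k) : k * row k q p + col k q p + q = p + k := by
  have := Nat.div_add_mod (p + k - q) k
  unfold row col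
  omega

theorem col_lt (hq : q < k) : col k q p < k := Nat.mod_lt _ (by omega)

theorem row_col_eq (hj : j < k) (h : k * a + j + q = p + k) :
    row k q p = a ∧ col k q p = j := by
  have hp : p + k - q = j + k * a := by omega
  unfold row col
  rw [hp, Nat.add_mul_div_left _ _ (by omega), Nat.add_mul_mod_self_left,
    Nat.div_eq_of_lt hj, Nat.mod_eq_of_lt hj]
  simp

theorem isCell_row_col (hq : q < k) (hp : p < k ^ 2) : IsCell k q (row k q p) (col k q p) := by
  have h := mul_row_add_col (p := p) hq
  have hj := col_lt (p := p) hq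
  have hk : row k q p ≤ k := by
    by_contra! hlt
    have : k * (k + 1) ≤ k * row k q p := Nat.mul_le_mul_left _ hlt
    nlinarith
  refine ⟨hk, hj, fun h0 => ?_, fun h0 => ?_⟩
  · rw [h0] at h; omega
  · rw [h0] at h; nlinarith

theorem le_add_iff_of_row_lt (hq : q < k) (hlt : row k q p < row k q p') :
    p' ≤ p + k ↔ row k q p' = row k q p + 1 ∧ col k q p' ≤ col k q p := by
  have h := mul_row_add_col (p := p) hq
  have hj := col_lt (p := p) hq
  have h' := mul_row_add_col (p := p') hq
  have hj' := col_lt (p := p') hq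
  rcases Nat.eq_or_lt_of_le (Nat.succ_le_of_lt hlt) with heq | hlt'
  · rw [← heq, Nat.mul_succ] at h'
    omega
  · have := Nat.mul_le_mul_left k (Nat.succ_le_of_lt hlt')
    simp only [Nat.mul_succ] at this
    omega

theorem near_row_col_iff (hq : q < k) :
    p ≤ p' + k ∧ p' ≤ p + k ↔
      NearCell (row k q p) (col k q p) (row k q p') (col k q p') := by
  have h := mul_row_add_col (p := p) hq
  have hj := col_lt (p := p) hq
  have h' := mul_row_add_col (p := p') hq
  have hj' := col_lt (p := p') hq
  unfold NearCell
  rcases lt_trichotomy (row k q p) (row k q p') with hlt | heq | hlt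
  · have := Nat.mul_le_mul_left k hlt.le
    rw [le_add_iff_of_row_lt hq hlt]
    omega
  · rw [heq] at h
    omega
  · have := Nat.mul_le_mul_left k hlt.le
    rw [le_add_iff_of_row_lt hq hlt]
    omega

theorem eq_of_row_eq_of_col_eq (hq : q < k) (hrow : row k q p = row k q p')
    (hcol : col k q p = col k q p') : p = p' := by
  have h := mul_row_add_col (p := p) hq
  have h' := mul_row_add_col (p := p') hq
  rw [hrow, hcol] at h
  omega

theorem row_col_last (hq : q < k) (hp : p + 1 = k ^ 2) :
    row k q p = k ∧ col k q p = k - 1 - q :=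
  row_col_eq (by omega) (by rw [pow_two] at hp; omega)

theorem row_col_mod (hk : 0 < k) (p : ℕ) : row k (p % k) p = p / k + 1 ∧ col k (p % k) p = 0 := by
  refine row_col_eq hk ?_
  have := Nat.div_add_mod p k
  rw [mul_add]
  omega

end Positions

section AddCells

variable {V : Type*} {k q : ℕ} {G : SimpleGraph V} {W T T' A B : Set V}

/-- The vertex `v` has no neighbours that are still to be added to `T`. -/
def Finished (G : SimpleGraph V) (W T : Set V) (v : V) : Prop :=
  ∀ u ∈ W, u ∉ T → ¬ G.Adj v u

theorem FewGroups.union_of_finished {c : V → ℕ} {δ γ : ℕ} {star : V} (hAB : Disjoint A B)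
    (hlt : ∀ y ∈ A, c y < k)
    (hadj : ∀ y ∈ A, ∀ z ∈ A, c y = c z → ∀ u ∈ W, u ∉ A ∪ B → G.Adj y u → G.Adj z u)
    (hδ : δ < k) (hdead : ∀ y ∈ A, c y = δ → Finished G W (A ∪ B) y)
    (hB : ∀ o ∈ B, o ≠ star → Finished G W (A ∪ B) o)
    (hstar : star ∈ B → Finished G W (A ∪ B) star ∨ γ < k ∧ γ ≠ δ ∧ ∀ y ∈ A, c y ≠ γ) :
    FewGroups k G W (A ∪ B) := by
  classical
  let f : V → ℕ := fun v => if v ∈ A then c v else if Finished G W (A ∪ B) v then δ else γ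
  have f_of_mem : ∀ y ∈ A, f y = c y := fun y hy => if_pos hy
  have f_of_mem_right : ∀ o ∈ B, Finished G W (A ∪ B) o ∧ f o = δ ∨
      ¬ Finished G W (A ∪ B) o ∧ o = star ∧ f o = γ ∧ γ < k ∧ γ ≠ δ ∧ ∀ y ∈ A, c y ≠ γ := by
    intro o ho
    have hoA : o ∉ A := fun h => Set.disjoint_left.1 hAB h ho
    by_cases hfin : Finished G W (A ∪ B) o
    · exact Or.inl ⟨hfin, by simp only [f, if_neg hoA, if_pos hfin]⟩
    · obtain rfl : o = star := by
        by_contra hne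
        exact hfin (hB o ho hne)
      exact Or.inr ⟨hfin, rfl, by simp only [f, if_neg hoA, if_neg hfin],
        (hstar ho).resolve_left hfin⟩
  refine ⟨f, ?_, ?_⟩
  · rintro y (hy | hy)
    · exact (f_of_mem y hy).trans_lt (hlt y hy)
    · rcases f_of_mem_right y hy with ⟨-, h⟩ | ⟨-, -, h, hγ, -⟩
      · exact h.trans_lt hδ
      · exact h.trans_lt hγ
  · rintro y (hy | hy) z (hz | hz) hyz u hu huT hyu
    · rw [f_of_mem y hy, f_of_mem z hz] at hyz
      exact hadj y hy z hz hyz u hu huT hyu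
    · rw [f_of_mem y hy] at hyz
      rcases f_of_mem_right z hz with ⟨-, h⟩ | ⟨-, -, h, -, -, hγ⟩
      · exact (hdead y hy (hyz.trans h) u hu huT hyu).elim
      · exact (hγ y hy (hyz.trans h)).elim
    · rw [f_of_mem z hz] at hyz
      rcases f_of_mem_right y hy with ⟨hfin, -⟩ | ⟨-, -, h, -, -, hγ⟩
      · exact (hfin u hu huT hyu).elim
      · exact (hγ z hz (hyz.symm.trans h)).elim
    · rcases f_of_mem_right y hy with ⟨hfin, -⟩ | ⟨-, rfl, h, -, hγ, -⟩
      · exact (hfin u hu huT hyu).elim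
      · rcases f_of_mem_right z hz with ⟨-, h'⟩ | ⟨-, rfl, -⟩
        · exact (hγ (h.symm.trans (hyz.trans h'))).elim
        · exact hyu

theorem NarrowPrefix.of_subsingleton_diff (h : NarrowPrefix k G W T) (hT : FewGroups k G W T)
    (hsub : T ⊆ T') (hone : (T' \ T).Subsingleton) (hW : T' ⊆ W) : NarrowPrefix k G W T' := by
  rcases hone.eq_empty_or_singleton with hdiff | ⟨x, hdiff⟩
  · rwa [(Set.sdiff_eq_empty.1 hdiff).antisymm hsub]
  · have hx : x ∈ T' \ T := hdiff ▸ Set.mem_singleton x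
    have hT' : T' = insert x T := by
      rw [Set.insert_eq, ← hdiff, Set.sdiff_union_of_subset hsub]
    exact hT' ▸ h.add hT (hW hx.1)

theorem NarrowPrefix.of_chain {S : ℕ → Set V} (N : ℕ) (h : NarrowPrefix k G W (S 0))
    (hS : ∀ t < N, FewGroups k G W (S t) ∧ S t ⊆ S (t + 1) ∧ (S (t + 1) \ S t).Subsingleton ∧
      S (t + 1) ⊆ W) :
    NarrowPrefix k G W (S N) := by
  induction N with
  | zero => exact h
  | succ N ih =>
    obtain ⟨hfew, hsub, hone, hW⟩ := hS N (Nat.lt_succ_self N)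
    exact (ih fun t ht => hS t (ht.trans (Nat.lt_succ_self N))).of_subsingleton_diff hfew hsub
      hone hW

variable {e : pathPower k (k ^ 2) ↪g G} {X Y M : ℕ → ℕ → Prop}

/-- The vertices at the cells in `X`. -/
def cells (e : pathPower k (k ^ 2) ↪g G) (q : ℕ) (X : ℕ → ℕ → Prop) : Set V :=
  e '' {p | X (row k q p) (col k q p)}

theorem mem_cells {p : Fin (k ^ 2)} : e p ∈ cells e q X ↔ X (row k q p) (col k q p) :=
  e.injective.mem_set_image

theorem cells_congr (hq : q < k) (h : ∀ a j, IsCell k q a j → (X a j ↔ Y a j)) :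
    cells e q X = cells e q Y := by
  unfold cells
  congr 1
  ext p
  exact h _ _ (isCell_row_col hq p.2)

theorem adj_iff_nearCell (hq : q < k) {p p' : Fin (k ^ 2)} :
    G.Adj (e p) (e p') ↔
      p ≠ p' ∧ NearCell (row k q p) (col k q p) (row k q p') (col k q p') := by
  rw [e.map_adj_iff, ← near_row_col_iff hq]
  rfl

theorem NarrowPrefix.of_cells_chain (hq : q < k) {X : ℕ → ℕ → ℕ → Prop} (N : ℕ)
    (h : NarrowPrefix k G W (cells e q (X 0) ∪ B))
    (hfew : ∀ t < N, FewGroups k G W (cells e q (X t) ∪ B)) (α β : ℕ → ℕ)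
    (hX : ∀ t < N, ∀ a j, IsCell k q a j → (X t a j → X (t + 1) a j) ∧
      (X (t + 1) a j → X t a j ∨ a = α t ∧ j = β t))
    (hW : ∀ t < N, cells e q (X (t + 1)) ⊆ W) :
    NarrowPrefix k G W (cells e q (X N) ∪ B) := by
  refine NarrowPrefix.of_chain (S := fun t => cells e q (X t) ∪ B) N h fun t ht =>
    ⟨hfew t ht, ?_, ?_, Set.union_subset (hW t ht) (Set.subset_union_right.trans h.subset)⟩
  · refine Set.union_subset_union_left _ (Set.image_mono fun p hp => ?_)
    exact (hX t ht _ _ (isCell_row_col hq p.2)).1 hp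
  · have new_cell : ∀ v ∈ (cells e q (X (t + 1)) ∪ B) \ (cells e q (X t) ∪ B),
        ∃ p : Fin (k ^ 2), e p = v ∧ row k q p = α t ∧ col k q p = β t := by
      rintro _ ⟨⟨p, hp, rfl⟩ | hv, hnot⟩
      · rcases (hX t ht _ _ (isCell_row_col hq p.2)).2 hp with hold | hnew
        · exact (hnot (Or.inl (mem_cells.2 hold))).elim
        · exact ⟨p, rfl, hnew⟩
      · exact (hnot (Or.inr hv)).elim
    intro v hv w hw
    obtain ⟨p, rfl, hrow, hcol⟩ := new_cell v hv
    obtain ⟨p', rfl, hrow', hcol'⟩ := new_cell w hw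
    exact congrArg e (Fin.ext (eq_of_row_eq_of_col_eq hq (hrow.trans hrow'.symm)
      (hcol.trans hcol'.symm)))

theorem IsCellColoring.fewGroups {c : ℕ → ℕ → ℕ} {δ γ : ℕ} {star : V}
    (h : IsCellColoring k q M X c δ) (hq : q < k)
    (hB : ∀ p, e p ∈ B → ¬ X (row k q p) (col k q p))
    (hM : ∀ p : Fin (k ^ 2), M (row k q p) (col k q p) → e p ∈ W → e p ∈ B)
    (hrange : ∀ p : Fin (k ^ 2), X (row k q p) (col k q p) →
      ∀ u ∈ W, u ∉ B → G.Adj (e p) u → u ∈ Set.range e)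
    (hfin : ∀ o ∈ B, o ≠ star → Finished G W (cells e q X ∪ B) o)
    (hstar : star ∈ B → Finished G W (cells e q X ∪ B) star ∨
      γ < k ∧ γ ≠ δ ∧ ∀ a j, IsCell k q a j → X a j → c a j ≠ γ) :
    FewGroups k G W (cells e q X ∪ B) := by
  let f : V → ℕ := Function.extend e (fun p => c (row k q p) (col k q p)) 0
  have f_apply : ∀ p, f (e p) = c (row k q p) (col k q p) := fun p => e.injective.extend_apply _ _ p
  have isCell : ∀ p : Fin (k ^ 2), IsCell k q (row k q p) (col k q p) :=
    fun p => isCell_row_col hq p.2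
  have exists_cell : ∀ p : Fin (k ^ 2), X (row k q p) (col k q p) → ∀ u ∈ W,
      u ∉ cells e q X ∪ B → G.Adj (e p) u → ∃ r : Fin (k ^ 2), u = e r ∧
        ¬ X (row k q r) (col k q r) ∧ ¬ M (row k q r) (col k q r) := by
    intro p hp u hu huT hadj
    obtain ⟨r, rfl⟩ := hrange p hp u hu (fun h => huT (Or.inr h)) hadj
    exact ⟨r, rfl, fun h => huT (Or.inl (mem_cells.2 h)), fun h => huT (Or.inr (hM r h hu))⟩
  refine FewGroups.union_of_finished (c := f) (δ := δ) (γ := γ) (star := star) ?_ ?_ ?_ h.dead_lt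
    ?_ hfin fun ho => (hstar ho).imp_right fun hγ => ⟨hγ.1, hγ.2.1, ?_⟩
  · rw [Set.disjoint_left]
    rintro _ ⟨p, hp, rfl⟩ hpB
    exact hB p hpB hp
  · rintro _ ⟨p, hp, rfl⟩
    exact (f_apply p).trans_lt (h.lt _ _ (isCell p) hp)
  · rintro _ ⟨p, hp, rfl⟩ _ ⟨p', hp', rfl⟩ hpp' u hu huT hadj
    obtain ⟨r, rfl, hrX, hrM⟩ := exists_cell p hp u hu huT hadj
    rw [f_apply, f_apply] at hpp'
    rw [adj_iff_nearCell hq] at hadj ⊢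
    refine ⟨fun hpr => hrX (hpr ▸ hp'), ?_⟩
    exact h.near _ _ _ _ (isCell p) (isCell p') hp hp' hpp' _ _ (isCell r) hrX hrM hadj.2
  · rintro _ ⟨p, hp, rfl⟩ hpδ u hu huT hadj
    obtain ⟨r, rfl, hrX, hrM⟩ := exists_cell p hp u hu huT hadj
    rw [f_apply] at hpδ
    exact h.dead _ _ (isCell p) hp hpδ _ _ (isCell r) hrX hrM ((adj_iff_nearCell hq).1 hadj).2
  · rintro _ ⟨p, hp, rfl⟩
    rw [f_apply]
    exact hγ.2.2 _ _ (isCell p) hp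

end AddCells

section Appendable

variable {V : Type*} {k : ℕ} {G : SimpleGraph V} {W Out : Set V} {e : pathPower k (k ^ 2) ↪g G}
  {d last : Fin (k ^ 2)} {q a₀ : ℕ} {star : V}

/-- The situation in which a path power is about to be added to the vertices in `Out`. The cells are
numbered with the shift `q`, such that the vertex `d`, which is missing in `W` unless it is the last
one, is in column `0`, in row `a₀`. If `d` is not the last vertex, then the vertex `star` of `Out`
may be adjacent to the last one; other adjacencies between `Out` and the path power are excluded. -/
structure Appendable (k : ℕ) (G : SimpleGraph V) (W Out : Set V) (e : pathPower k (k ^ 2) ↪g G)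
    (d last : Fin (k ^ 2)) (q a₀ : ℕ) (star : V) : Prop where
  three_le : 3 ≤ k
  shift_lt : q < k
  row_eq : row k q d = a₀
  col_eq : col k q d = 0
  last_add_one : last.val + 1 = k ^ 2
  narrow : NarrowPrefix k G W Out
  not_mem_out : ∀ p, e p ∉ Out
  mem_of_ne : ∀ p, p ≠ d → e p ∈ W
  eq_last_of_mem : e d ∈ W → d = last
  mem_range : ∀ p, p ≠ d → ∀ u ∈ W, u ∉ Out → G.Adj (e p) u → u ∈ Set.range e
  out_adj : ∀ o ∈ Out, ∀ u ∈ W, u ∉ Out → G.Adj o u → o = star ∧ u = e last ∧ d ≠ last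

namespace Appendable

variable (h : Appendable k G W Out e d last q a₀ star)

include h

theorem eq_of_cell {p : Fin (k ^ 2)} (hrow : row k q p = a₀) (hcol : col k q p = 0) : p = d :=
  Fin.ext (eq_of_row_eq_of_col_eq h.shift_lt (hrow.trans h.row_eq.symm) (hcol.trans h.col_eq.symm))

theorem one_le_row : 1 ≤ a₀ := by
  have hpos := mul_row_add_col (p := d) h.shift_lt
  have hlt := h.shift_lt
  rw [h.row_eq, h.col_eq] at hpos
  by_contra! hlt'
  obtain rfl : a₀ = 0 := by omega
  omega

theorem row_le : a₀ ≤ k := h.row_eq ▸ (isCell_row_col h.shift_lt d.2).1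

theorem eq_last (ha₀ : a₀ = k) (hq : q + 1 = k) : d = last := by
  obtain ⟨hrow, hcol⟩ := row_col_last h.shift_lt h.last_add_one
  exact (h.eq_of_cell (hrow.trans ha₀.symm) (by omega)).symm

theorem not_mem_of_innerGap {p : Fin (k ^ 2)} (hp : InnerGap k q a₀ (row k q p) (col k q p)) :
    e p ∉ W := by
  obtain ⟨hrow, hcol, hne⟩ := hp
  obtain rfl := h.eq_of_cell hrow hcol
  intro hpW
  obtain rfl := h.eq_last_of_mem hpW
  obtain ⟨hrow', hcol'⟩ := row_col_last h.shift_lt h.last_add_one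
  have := h.shift_lt
  omega

variable {X M : ℕ → ℕ → Prop} {c : ℕ → ℕ → ℕ} {δ : ℕ}

theorem cells_subset (hX : ¬ X a₀ 0) : cells e q X ⊆ W := by
  rintro _ ⟨p, hp, rfl⟩
  refine h.mem_of_ne p ?_
  rintro rfl
  rw [Set.mem_ofPred_eq, h.row_eq, h.col_eq] at hp
  exact hX hp

theorem finished_of_last_mem (hX : X k (k - 1 - q) ∨ a₀ = k ∧ q + 1 = k) {o : V} (ho : o ∈ Out) :
    Finished G W (cells e q X ∪ Out) o := by
  intro u hu huT hadj
  obtain ⟨-, rfl, hne⟩ := h.out_adj o ho u hu (fun hO => huT (Or.inr hO)) hadj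
  rcases hX with hX | ⟨ha₀, hq⟩
  · obtain ⟨hrow, hcol⟩ := row_col_last h.shift_lt h.last_add_one
    exact huT (Or.inl (mem_cells.2 (by rwa [hrow, hcol])))
  · exact hne (h.eq_last ha₀ hq)

/-- As long as the last vertex is missing, the group `k - 1` is used for `star`. -/
theorem fewGroups (hc : IsCellColoring k q M X c δ) (hX : ¬ X a₀ 0)
    (hM : ∀ p : Fin (k ^ 2), M (row k q p) (col k q p) → e p ∉ W)
    (hstar : (X k (k - 1 - q) ∨ a₀ = k ∧ q + 1 = k) ∨
      k - 1 ≠ δ ∧ ∀ a j, IsCell k q a j → X a j → c a j ≠ k - 1) :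
    FewGroups k G W (cells e q X ∪ Out) := by
  have hlt := h.shift_lt
  refine hc.fewGroups (star := star) (γ := k - 1) h.shift_lt
    (fun p hp => (h.not_mem_out p hp).elim) (fun p hp hpW => (hM p hp hpW).elim) ?_ ?_ ?_
  · intro p hp
    refine h.mem_range p ?_
    rintro rfl
    rw [h.row_eq, h.col_eq] at hp
    exact hX hp
  · intro o ho hne u hu huT hadj
    exact hne (h.out_adj o ho u hu (fun hO => huT (Or.inr hO)) hadj).1
  · exact fun ho => hstar.imp (fun hX => h.finished_of_last_mem hX ho)
      fun hδ => ⟨Nat.sub_one_lt (by omega), hδ.1, hδ.2⟩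

theorem fewGroups_stairs (s m : ℕ) : FewGroups k G W (cells e q (stairs s m) ∪ Out) := by
  have hk := h.three_le
  have hlt := h.shift_lt
  refine h.fewGroups (isCellColoring_stairs (M := InnerGap k q a₀) (by omega) s m)
    (by unfold stairs; omega) (fun p => h.not_mem_of_innerGap) ?_
  by_cases hq : q + 1 = k
  · refine Or.inr ⟨by omega, fun a j ha hX => ?_⟩
    have := (stairsColor_mem ha hX).2.2 hq
    omega
  · by_cases hX : stairs s m k (k - 1 - q)
    · exact Or.inl (Or.inl hX)
    · refine Or.inr ⟨by omega, fun a j ha hX' hcol => ?_⟩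
      unfold stairs IsCell stairsColor at *
      split_ifs at hcol <;> omega

theorem narrowPrefix_stairs : NarrowPrefix k G W (cells e q (stairs 0 0) ∪ Out) := by
  have fill_row : ∀ s, NarrowPrefix k G W (cells e q (stairs s k) ∪ Out) →
      NarrowPrefix k G W (cells e q (stairs s 0) ∪ Out) := by
    intro s hs
    simpa only [Nat.sub_self] using NarrowPrefix.of_cells_chain h.shift_lt
      (X := fun t => stairs s (k - t)) k hs (fun t _ => h.fewGroups_stairs s _) (fun _ => s)
      (fun t => k - (t + 1)) (fun t _ a j _ => by unfold stairs; omega)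
      (fun t _ => h.cells_subset (by unfold stairs; omega))
  have rows : ∀ i ≤ k, NarrowPrefix k G W (cells e q (stairs (k - i) k) ∪ Out) := by
    intro i
    induction i with
    | zero =>
      intro _
      have hempty : cells e q (stairs (k - 0) k) ⊆ Out := by
        rintro _ ⟨p, hp, rfl⟩
        have := isCell_row_col h.shift_lt p.2
        simp only [Set.mem_ofPred_eq, stairs] at hp
        unfold IsCell at this
        omega
      rw [Set.union_eq_right.2 hempty]
      exact h.narrow
    | succ i ih =>
      intro hi
      rw [cells_congr h.shift_lt (Y := stairs (k - i) 0)]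
      · exact fill_row _ (ih (by omega))
      · intro a j ha
        unfold stairs IsCell at *
        omega
  exact fill_row 0 (by simpa only [Nat.sub_self] using rows k le_rfl)

theorem fewGroups_leftUpper (t : ℕ) : FewGroups k G W (cells e q (leftUpper a₀ t) ∪ Out) := by
  have hk := h.three_le
  refine h.fewGroups (isCellColoring_leftUpper h.one_le_row (by omega) t)
    (by unfold leftUpper; omega) (fun p => h.not_mem_of_innerGap) ?_
  by_cases hX : leftUpper a₀ t k (k - 1 - q) ∨ a₀ = k ∧ q + 1 = k
  · exact Or.inl hX
  · unfold leftUpper at *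
    refine Or.inr ⟨by omega, fun a j ha hX' => ?_⟩
    unfold IsCell at ha
    omega

theorem narrowPrefix_leftUpper :
    NarrowPrefix k G W (cells e q (leftUpper a₀ (k + 1)) ∪ Out) := by
  refine NarrowPrefix.of_cells_chain h.shift_lt (X := leftUpper a₀) (k + 1) ?_
    (fun t _ => h.fewGroups_leftUpper t) id (fun _ => 0) (fun t _ a j _ => ?_)
    fun t _ => h.cells_subset ?_
  · rw [cells_congr h.shift_lt (Y := stairs 0 0)]
    · exact h.narrowPrefix_stairs
    · intro a j _
      unfold stairs leftUpper
      omega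
  · unfold leftUpper
    simp only [id]
    omega
  · unfold leftUpper
    omega

theorem narrowPrefix_diagonal : NarrowPrefix k G W (cells e q (diagonal a₀ 0) ∪ Out) := by
  have hlt := h.shift_lt
  have hfew : ∀ s, FewGroups k G W (cells e q (diagonal a₀ s) ∪ Out) := fun s => by
    have := h.row_le
    exact h.fewGroups (isCellColoring_diagonal h.one_le_row h.row_le s)
      (by unfold diagonal; omega) (fun p => h.not_mem_of_innerGap)
      (Or.inl (by unfold diagonal; omega))
  rw [← Nat.sub_self k]
  refine NarrowPrefix.of_cells_chain h.shift_lt (X := fun t => diagonal a₀ (k - t)) k ?_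
    (fun t _ => hfew _) (fun t => k - (t + 1)) (fun t => k - (t + 1)) (fun t _ a j _ => ?_)
    fun t _ => h.cells_subset ?_
  · rw [cells_congr h.shift_lt (Y := leftUpper a₀ (k + 1))]
    · exact h.narrowPrefix_leftUpper
    · intro a j ha
      unfold diagonal leftUpper IsCell at *
      omega
  · unfold diagonal
    omega
  · unfold diagonal
    have := h.one_le_row
    omega

theorem narrowPrefix_leftLower :
    NarrowPrefix k G W (cells e q (leftLower a₀ (k + 1)) ∪ Out) := by
  have hlt := h.shift_lt
  have hle := h.row_le
  have hfew : ∀ t, FewGroups k G W (cells e q (leftLower a₀ t) ∪ Out) := fun t =>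
    h.fewGroups (isCellColoring_leftLower h.three_le h.shift_lt h.row_le t)
      (by unfold leftLower; omega)
      (fun p => h.not_mem_of_innerGap) (Or.inl (by unfold leftLower; omega))
  refine NarrowPrefix.of_cells_chain h.shift_lt (X := leftLower a₀) (k + 1) ?_
    (fun t _ => hfew t) id (fun _ => 0) (fun t _ a j _ => ?_) fun t _ => h.cells_subset ?_
  · rw [cells_congr h.shift_lt (Y := diagonal a₀ 0)]
    · exact h.narrowPrefix_diagonal
    · intro a j _
      unfold diagonal leftLower
      omega
  · unfold leftLower
    simp only [id]
    omega
  · unfold leftLower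
    omega

theorem narrowPrefix_columns (hd : e d ∉ W) {m : ℕ} (hm : m < k) :
    NarrowPrefix k G W (cells e q (columns a₀ m 0) ∪ Out) := by
  have hlt := h.shift_lt
  have hle := h.row_le
  have hfew : ∀ m t, FewGroups k G W (cells e q (columns a₀ m t) ∪ Out) := fun m t =>
    h.fewGroups (isCellColoring_columns h.three_le h.shift_lt h.one_le_row h.row_le m t)
      (by unfold columns; omega) (fun p hp => h.eq_of_cell hp.1 hp.2 ▸ hd)
      (Or.inl (by unfold columns; omega))
  induction hi : k - 1 - m generalizing m with
  | zero =>
    rw [cells_congr h.shift_lt (Y := leftLower a₀ (k + 1))]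
    · exact h.narrowPrefix_leftLower
    · intro a j ha
      unfold columns leftLower IsCell at *
      omega
  | succ i ih =>
    rw [cells_congr h.shift_lt (Y := columns a₀ (m + 1) k)]
    · refine NarrowPrefix.of_cells_chain h.shift_lt (X := columns a₀ (m + 1)) k
        (ih (by omega) (by omega)) (fun t _ => hfew (m + 1) t) id (fun _ => m + 1)
        (fun t _ a j _ => ?_) fun t _ => h.cells_subset (by unfold columns; omega)
      unfold columns
      simp only [id]
      omega
    · intro a j ha
      unfold columns IsCell at *
      omega

theorem cells_columns_zero : cells e q (columns a₀ 0 0) = e '' {p | p ≠ d} := by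
  unfold cells
  congr 1
  ext p
  constructor
  · rintro hp rfl
    rw [Set.mem_ofPred_eq, h.row_eq, h.col_eq] at hp
    unfold columns at hp
    have := h.one_le_row
    omega
  · intro hp
    have hne : ¬ (row k q p = a₀ ∧ col k q p = 0) := fun hc => hp (h.eq_of_cell hc.1 hc.2)
    rw [Set.mem_ofPred_eq]
    unfold columns
    omega

theorem narrowPrefix_image_ne (hd : e d ∉ W) :
    NarrowPrefix k G W (e '' {p | p ≠ d} ∪ Out) :=
  h.cells_columns_zero ▸ h.narrowPrefix_columns hd (Nat.zero_lt_of_lt h.shift_lt)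

end Appendable

/-- The vertices `Y 0, ..., Y r` form a path that starts in the last vertex of the path power `e`
and continues outside of it. Only `Y r` may have neighbours other than those in the path and those
of `Y 0` in the path power. -/
structure IsTail (G : SimpleGraph V) (W Out : Set V) (e : pathPower k (k ^ 2) ↪g G)
    (last : Fin (k ^ 2)) (Y : ℕ → V) (r : ℕ) : Prop where
  zero_eq : Y 0 = e last
  mem : ∀ j ≤ r, Y j ∈ W
  not_mem_range : ∀ j, 1 ≤ j → j ≤ r → Y j ∉ Set.range e
  adj : ∀ j < r, ∀ u ∈ W, u ∉ Out → G.Adj (Y j) u →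
    (∃ i ≤ j + 1, u = Y i) ∨ j = 0 ∧ u ∈ Set.range e

namespace Appendable

variable {Y : ℕ → V} {r : ℕ} (h : Appendable k G W Out e last last (k - 1) k star)
  (hY : IsTail G W Out e last Y r)

include h

theorem fewGroups_lastColumn (t : ℕ) :
    FewGroups k G W (cells e (k - 1) (columns k (k - 1) t) ∪ Out) := by
  have hk := h.three_le
  exact h.fewGroups (isCellColoring_lastColumn hk t) (by unfold columns; omega)
    (fun _ hM => hM.elim) (Or.inl (Or.inr ⟨rfl, by omega⟩))

theorem narrowPrefix_lastColumn :
    NarrowPrefix k G W (cells e (k - 1) (columns k (k - 1) k) ∪ Out) := by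
  refine NarrowPrefix.of_cells_chain h.shift_lt (X := columns k (k - 1)) k ?_
    (fun t _ => h.fewGroups_lastColumn t) id (fun _ => k - 1) (fun t _ a j _ => ?_)
    fun t _ => h.cells_subset (by unfold columns; omega)
  · rw [cells_congr h.shift_lt (Y := leftLower k (k + 1))]
    · exact h.narrowPrefix_leftLower
    · intro a j ha
      unfold columns leftLower IsCell at *
      omega
  · unfold columns
    simp only [id]
    omega

theorem cells_columns_last :
    cells e (k - 1) (columns k (k - 1) k) = cells e (k - 1) (columns k (k - 2) 0) :=
  cells_congr h.shift_lt fun a j ha => by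
    have hk := h.three_le
    unfold columns IsCell at *
    omega

include hY

theorem finished_of_lt {m t i j : ℕ} (hij : j < i) (hi : i ≤ r) :
    Finished G W (cells e (k - 1) (columns k m t) ∪ (Out ∪ Y '' {j | j ≤ i})) (Y j) := by
  intro u hu huT hadj
  rcases hY.adj j (by omega) u hu (fun hO => huT (Or.inr (Or.inl hO))) hadj with
    ⟨i', hi', rfl⟩ | ⟨rfl, p, rfl⟩
  · exact huT (Or.inr (Or.inr ⟨i', by simp only [Set.mem_ofPred_eq]; omega, rfl⟩))
  · have hne : ¬ (row k (k - 1) p = k ∧ col k (k - 1) p = 0) := fun hc =>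
      huT (Or.inr (Or.inr ⟨0, Nat.zero_le i, by rw [hY.zero_eq, h.eq_of_cell hc.1 hc.2]⟩))
    rw [hY.zero_eq, adj_iff_nearCell h.shift_lt, h.row_eq, h.col_eq] at hadj
    have hcell := isCell_row_col h.shift_lt p.2
    refine huT (Or.inl (mem_cells.2 ?_))
    have hk := h.three_le
    unfold columns IsCell NearCell at *
    omega

theorem fewGroups_spareColumns {m i : ℕ} (hm : m + 2 ≤ k) (hi : i ≤ r) (t : ℕ) :
    FewGroups k G W (cells e (k - 1) (columns k m t) ∪ (Out ∪ Y '' {j | j ≤ i})) := by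
  have hk := h.three_le
  have hX : ¬ columns k m t k 0 := by unfold columns; omega
  refine (isCellColoring_spareColumns hk hm t).fewGroups (star := Y i) (γ := k - 2) h.shift_lt
    ?_ ?_ ?_ ?_
    fun _ => Or.inr ⟨by omega, by omega, fun a j ha _ => spareColor_ne hk ha⟩
  · rintro p (hp | ⟨j, hj, hp⟩)
    · exact (h.not_mem_out p hp).elim
    · rcases Nat.eq_zero_or_pos j with rfl | hj0
      · rw [hY.zero_eq] at hp
        rwa [← e.injective hp, h.row_eq, h.col_eq]
      · exact (hY.not_mem_range j hj0 (hj.trans hi) ⟨p, hp.symm⟩).elim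
  · exact fun p hp _ =>
      Or.inr ⟨0, Nat.zero_le i, by rw [hY.zero_eq, h.eq_of_cell hp.1 hp.2]⟩
  · intro p hp u hu huO
    refine h.mem_range p ?_ u hu fun hO => huO (Or.inl hO)
    rintro rfl
    rw [h.row_eq, h.col_eq] at hp
    exact hX hp
  · rintro o (ho | ⟨j, hj, rfl⟩) hne
    · exact fun u hu huT hadj =>
        (h.out_adj o ho u hu (fun hO => huT (Or.inr (Or.inl hO))) hadj).2.2 rfl
    · exact h.finished_of_lt hY (lt_of_le_of_ne hj fun hji => hne (by rw [hji])) hi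

theorem narrowPrefix_tail {i : ℕ} (hi : i ≤ r) :
    NarrowPrefix k G W (cells e (k - 1) (columns k (k - 2) 0) ∪ (Out ∪ Y '' {j | j ≤ i})) := by
  have hk := h.three_le
  have hlast : NarrowPrefix k G W (cells e (k - 1) (columns k (k - 2) 0) ∪ Out) :=
    h.cells_columns_last ▸ h.narrowPrefix_lastColumn
  induction i with
  | zero =>
    have hfew : FewGroups k G W (cells e (k - 1) (columns k (k - 2) 0) ∪ Out) :=
      h.cells_columns_last ▸ h.fewGroups_lastColumn k
    convert hlast.add hfew (hY.mem 0 hi) using 1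
    ext v
    simp only [Nat.le_zero_eq, Set.ofPred_eq_eq_singleton, Set.image_singleton,
      Set.union_singleton, Set.union_insert]
  | succ i ih =>
    convert (ih (by omega)).add (h.fewGroups_spareColumns hY (by omega) (by omega) 0)
      (hY.mem (i + 1) hi) using 1
    rw [← Set.union_insert, ← Set.union_insert, ← Set.image_insert_eq]
    congr 3
    ext j
    simp only [Set.mem_ofPred_eq, Set.mem_insert_iff]
    omega

theorem narrowPrefix_spareColumns {m : ℕ} (hm : m + 2 ≤ k) :
    NarrowPrefix k G W (cells e (k - 1) (columns k m 0) ∪ (Out ∪ Y '' {j | j ≤ r})) := by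
  induction hi : k - 2 - m generalizing m with
  | zero =>
    obtain rfl : m = k - 2 := by omega
    exact h.narrowPrefix_tail hY le_rfl
  | succ i ih =>
    rw [cells_congr h.shift_lt (Y := columns k (m + 1) k)]
    · refine NarrowPrefix.of_cells_chain h.shift_lt (X := columns k (m + 1)) k
        (ih (by omega) (by omega))
        (fun t _ => h.fewGroups_spareColumns hY (by omega) le_rfl t) id (fun _ => m + 1)
        (fun t _ a j _ => ?_) fun t _ => h.cells_subset (by unfold columns; omega)
      unfold columns
      simp only [id]
      omega
    · intro a j ha
      unfold columns IsCell at *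
      omega

theorem narrowPrefix_range_union_tail :
    NarrowPrefix k G W (Set.range e ∪ (Out ∪ Y '' {j | j ≤ r})) := by
  have hk := h.three_le
  convert h.narrowPrefix_spareColumns hY (m := 0) (by omega) using 1
  rw [h.cells_columns_zero]
  have hlast : e last ∈ Out ∪ Y '' {j | j ≤ r} := Or.inr ⟨0, Nat.zero_le r, hY.zero_eq⟩
  ext v
  constructor
  · rintro (⟨p, rfl⟩ | hv)
    · by_cases hp : p = last
      · exact Or.inr (hp ▸ hlast)
      · exact Or.inl ⟨p, hp, rfl⟩
    · exact Or.inr hv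
  · rintro (⟨p, -, rfl⟩ | hv)
    · exact Or.inl ⟨p, rfl⟩
    · exact Or.inr hv

end Appendable

end Appendable

section Linked

variable {V : Type*} {G : SimpleGraph V} {k l : ℕ} {e e' z : ℕ → V}

/-- The positions `p` and `q` of a layout are at distance at most `k`. -/
def Close (k p q : ℕ) : Prop := p ≤ q + k ∧ q ≤ p + k

/-- `G` consists of the `k`-path powers with layouts `e 0, ..., e (k * k - 1)` and
`e' 0, ..., e' (k * k - 1)` and of the path `z 0, ..., z (l + 1)` between their last vertices. The
conditions are symmetric in the two path powers, which is why `MGraph k l` is only studied through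
them. -/
structure Linked (G : SimpleGraph V) (k l : ℕ) (e e' z : ℕ → V) : Prop where
  inj : ∀ p < k * k, ∀ q < k * k, e p = e q → p = q
  inj' : ∀ p < k * k, ∀ q < k * k, e' p = e' q → p = q
  inj_path : ∀ i, 1 ≤ i → i ≤ l → ∀ j, 1 ≤ j → j ≤ l → z i = z j → i = j
  disjoint : ∀ p < k * k, ∀ q < k * k, e p ≠ e' q
  ne : ∀ i, 1 ≤ i → i ≤ l → ∀ p < k * k, z i ≠ e p
  ne' : ∀ i, 1 ≤ i → i ≤ l → ∀ p < k * k, z i ≠ e' p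
  cover : ∀ v, (∃ p < k * k, v = e p) ∨ (∃ p < k * k, v = e' p) ∨ ∃ i, 1 ≤ i ∧ i ≤ l ∧ v = z i
  first : z 0 = e (k * k - 1)
  last : z (l + 1) = e' (k * k - 1)
  adj : ∀ p < k * k, ∀ q < k * k, G.Adj (e p) (e q) ↔ p ≠ q ∧ Close k p q
  adj' : ∀ p < k * k, ∀ q < k * k, G.Adj (e' p) (e' q) ↔ p ≠ q ∧ Close k p q
  adj_path : ∀ i ≤ l, G.Adj (z i) (z (i + 1))
  out : ∀ p < k * k, ∀ v, G.Adj (e p) v → (∃ q < k * k, v = e q) ∨ p + 1 = k * k ∧ v = z 1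
  out' : ∀ p < k * k, ∀ v, G.Adj (e' p) v → (∃ q < k * k, v = e' q) ∨ p + 1 = k * k ∧ v = z l
  out_path : ∀ i, 1 ≤ i → i ≤ l → ∀ v, G.Adj (z i) v → v = z (i - 1) ∨ v = z (i + 1)

namespace Linked

theorem symm (h : Linked G k l e e' z) : Linked G k l e' e fun i => z (l + 1 - i) where
  inj := h.inj'
  inj' := h.inj
  inj_path i hi hil j hj hjl hij := by
    have := h.inj_path _ (by omega) (by omega) _ (by omega) (by omega) hij
    omega
  disjoint p hp q hq he := h.disjoint q hq p hp he.symm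
  ne i hi hil p hp := h.ne' _ (by omega) (by omega) p hp
  ne' i hi hil p hp := h.ne _ (by omega) (by omega) p hp
  cover v := by
    rcases h.cover v with hv | hv | ⟨i, hi, hil, rfl⟩
    · exact Or.inr (Or.inl hv)
    · exact Or.inl hv
    · exact Or.inr (Or.inr ⟨l + 1 - i, by omega, by omega, by congr 1; omega⟩)
  first := h.last
  last := by
    rw [Nat.sub_self]
    exact h.first
  adj := h.adj'
  adj' := h.adj
  adj_path i hi := by
    have := (h.adj_path (l - i) (Nat.sub_le l i)).symm
    rwa [show l - i + 1 = l + 1 - i by omega, show l - i = l + 1 - (i + 1) by omega] at this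
  out := h.out'
  out' p hp v hv := by
    rw [Nat.add_sub_cancel_left]
    exact h.out p hp v hv
  out_path i hi hil v hv := by
    rw [show l + 1 - (i - 1) = l + 1 - i + 1 by omega,
      show l + 1 - (i + 1) = l + 1 - i - 1 by omega]
    exact (h.out_path _ (by omega) (by omega) v hv).symm

section UpperBound

variable {W Out : Set V}

/-- The path power with layout `e`. -/
def embedding (h : Linked G k l e e' z) : pathPower k (k ^ 2) ↪g G where
  toFun p := e p
  inj' p q hpq := Fin.ext (h.inj p (sq k ▸ p.2) q (sq k ▸ q.2) hpq)
  map_rel_iff' {p q} :=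
    (h.adj p (sq k ▸ p.2) q (sq k ▸ q.2)).trans (and_congr_left' Fin.val_injective.ne_iff)

theorem range_embedding (h : Linked G k l e e' z) :
    Set.range h.embedding = e '' Set.Iio (k * k) := by
  ext v
  exact ⟨fun ⟨p, hp⟩ => ⟨p, sq k ▸ p.2, hp⟩, fun ⟨p, hp, hv⟩ => ⟨⟨p, (sq k).symm ▸ hp⟩, hv⟩⟩

theorem exists_last (hk : 0 < k) : ∃ last : Fin (k ^ 2), last.val + 1 = k ^ 2 :=
  ⟨⟨k ^ 2 - 1, Nat.sub_one_lt (pow_pos hk 2).ne'⟩, Nat.sub_add_cancel (pow_pos hk 2)⟩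

theorem embedding_last (h : Linked G k l e e' z) {p : Fin (k ^ 2)} (hp : p.val + 1 = k ^ 2) :
    h.embedding p = z 0 := by
  rw [h.first, ← Nat.eq_sub_of_add_eq (hp.trans (sq k))]
  rfl

theorem isTail (h : Linked G k l e e' z) {r : ℕ} (hr : r ≤ l) (hz : ∀ j ≤ r, z j ∈ W)
    {last : Fin (k ^ 2)} (hlast : last.val + 1 = k ^ 2) :
    IsTail G W Out h.embedding last z r where
  zero_eq := (h.embedding_last hlast).symm
  mem := hz
  not_mem_range j hj hjr hmem := by
    obtain ⟨p, hp⟩ := hmem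
    exact h.ne j hj (hjr.trans hr) p (sq k ▸ p.2) hp.symm
  adj j hj u _ _ hadj := by
    rcases Nat.eq_zero_or_pos j with rfl | hj0
    · rw [h.first] at hadj
      have hpos : 0 < k * k := sq k ▸ Nat.zero_lt_of_lt last.2
      rcases h.out _ (Nat.sub_one_lt hpos.ne') u hadj with ⟨q, hq, rfl⟩ | ⟨-, hu⟩
      · exact Or.inr ⟨rfl, ⟨⟨q, (sq k).symm ▸ hq⟩, rfl⟩⟩
      · exact Or.inl ⟨1, le_rfl, hu⟩
    · rcases h.out_path j hj0 (by omega) u hadj with hu | hu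
      · exact Or.inl ⟨j - 1, by omega, hu⟩
      · exact Or.inl ⟨j + 1, le_rfl, hu⟩

theorem appendable_last (h : Linked G k l e e' z) (hk : 3 ≤ k) (hW : ∀ p < k * k, e p ∈ W)
    (hOut : NarrowPrefix k G W Out) (hdisj : ∀ p < k * k, e p ∉ Out)
    (hfin : ∀ o ∈ Out, Finished G W Out o) {last : Fin (k ^ 2)} (hlast : last.val + 1 = k ^ 2) :
    Appendable k G W Out h.embedding last last (k - 1) k (z 0) where
  three_le := hk
  shift_lt := by omega
  row_eq := (row_col_last (by omega) hlast).1
  col_eq := by rw [(row_col_last (by omega) hlast).2, Nat.sub_self]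
  last_add_one := hlast
  narrow := hOut
  not_mem_out p := hdisj p (sq k ▸ p.2)
  mem_of_ne p _ := hW p (sq k ▸ p.2)
  eq_last_of_mem _ := rfl
  mem_range p hp u _ _ hadj := by
    rw [range_embedding]
    rcases h.out p (sq k ▸ p.2) u hadj with ⟨q, hq, rfl⟩ | ⟨hp', -⟩
    · exact ⟨q, hq, rfl⟩
    · exact (hp (Fin.ext (Nat.succ_injective (hp'.trans (hlast.trans (sq k)).symm)))).elim
  out_adj o ho u hu huO hadj := (hfin o ho u hu huO hadj).elim

theorem narrowPrefix_union_path (h : Linked G k l e e' z) (hk : 3 ≤ k) {r : ℕ} (hr : r ≤ l)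
    (hW : ∀ p < k * k, e p ∈ W) (hz : ∀ j, 1 ≤ j → j ≤ r → z j ∈ W)
    (hOut : NarrowPrefix k G W Out) (hdisj : ∀ p < k * k, e p ∉ Out)
    (hfin : ∀ o ∈ Out, Finished G W Out o) :
    NarrowPrefix k G W (Out ∪ e '' Set.Iio (k * k) ∪ z '' Set.Icc 1 r) := by
  obtain ⟨last, hlast⟩ := exists_last (k := k) (by omega)
  have hz0 : z 0 ∈ e '' Set.Iio (k * k) :=
    h.range_embedding ▸ h.embedding_last hlast ▸ Set.mem_range_self last
  have hzW : ∀ j ≤ r, z j ∈ W := fun j hj => by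
    rcases Nat.eq_zero_or_pos j with rfl | hj0
    · exact h.embedding_last hlast ▸ hW last (sq k ▸ last.2)
    · exact hz j hj0 hj
  convert (h.appendable_last hk hW hOut hdisj hfin hlast).narrowPrefix_range_union_tail
    (h.isTail hr hzW hlast) using 1
  have hIcc : {j | j ≤ r} = insert 0 (Set.Icc 1 r) := by
    ext j
    simp only [Set.mem_ofPred_eq, Set.mem_insert_iff, Set.mem_Icc]
    omega
  rw [h.range_embedding, ← Set.union_assoc, Set.union_comm _ Out, hIcc, Set.image_insert_eq,
    Set.union_insert, Set.insert_eq_of_mem]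
  exact Or.inl (Or.inr hz0)

theorem compl_image (h : Linked G k l e e' z) :
    (e '' Set.Iio (k * k))ᶜ =
      e' '' Set.Iio (k * k) ∪ (fun i => z (l + 1 - i)) '' Set.Icc 1 l := by
  ext v
  constructor
  · intro hv
    rcases h.cover v with ⟨p, hp, rfl⟩ | ⟨p, hp, rfl⟩ | ⟨i, hi, hil, rfl⟩
    · exact (hv ⟨p, hp, rfl⟩).elim
    · exact Or.inl ⟨p, hp, rfl⟩
    · exact Or.inr ⟨l + 1 - i, ⟨by omega, by omega⟩, by simp only; congr 1; omega⟩
  · rintro (⟨q, hq, rfl⟩ | ⟨i, ⟨hi, hil⟩, rfl⟩) ⟨p, hp, hpv⟩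
    · exact h.disjoint p hp q hq hpv
    · exact h.ne _ (by omega) (by omega) p hp hpv.symm

theorem compl_embedding_eq (h : Linked G k l e e' z) {d : Fin (k ^ 2)} :
    {h.embedding d}ᶜ = h.embedding '' {p | p ≠ d} ∪ (e '' Set.Iio (k * k))ᶜ := by
  have hne : h.embedding '' {p | p ≠ d} = Set.range h.embedding \ {h.embedding d} := by
    rw [← Set.image_univ, ← Set.image_singleton, ← Set.image_sdiff h.embedding.injective]
    congr 1
    ext p
    simp
  rw [hne, ← h.range_embedding, Set.union_comm, Set.compl_eq_univ_sdiff, Set.compl_eq_univ_sdiff]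
  ext v
  by_cases hv : v ∈ Set.range h.embedding
  · simp [hv]
  · simp [hv, ne_of_mem_of_not_mem (Set.mem_range_self d) hv |>.symm]

theorem narrowPrefix_compl_embedding (h : Linked G k l e e' z) (hk : 3 ≤ k) {d : ℕ}
    (hd : d < k * k) : NarrowPrefix k G {e d}ᶜ {e d}ᶜ := by
  obtain ⟨last, hlast⟩ := exists_last (k := k) (by omega)
  obtain ⟨hrow, hcol⟩ := row_col_mod (k := k) (by omega) d
  have hOut : NarrowPrefix k G {e d}ᶜ (e '' Set.Iio (k * k))ᶜ := by
    have := h.symm.narrowPrefix_union_path (W := {e d}ᶜ) hk le_rfl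
      (fun p hp => (h.disjoint d hd p hp).symm) (fun j hj hjl => h.ne _ (by omega) (by omega) d hd)
      .empty (fun _ _ => Set.notMem_empty _) fun o ho => ho.elim
    rwa [Set.empty_union, ← h.compl_image] at this
  let d' : Fin (k ^ 2) := ⟨d, (sq k).symm ▸ hd⟩
  have happ : Appendable k G {e d}ᶜ (e '' Set.Iio (k * k))ᶜ h.embedding d' last
      (d % k) (d / k + 1) (z 1) := {
    three_le := hk
    shift_lt := Nat.mod_lt d (by omega)
    row_eq := hrow
    col_eq := hcol
    last_add_one := hlast
    narrow := hOut
    not_mem_out := fun p hp => hp ⟨p, sq k ▸ p.2, rfl⟩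
    mem_of_ne := fun p hp hpd => hp (h.embedding.injective hpd)
    eq_last_of_mem := fun hmem => (hmem rfl).elim
    mem_range := fun p _ u _ hu _ => h.range_embedding ▸ Set.notMem_compl_iff.1 hu
    out_adj := fun o ho u hu huO hadj => by
      obtain ⟨p, hp, rfl⟩ := Set.notMem_compl_iff.1 huO
      rcases h.out p hp o hadj.symm with ⟨q, hq, rfl⟩ | ⟨hp', rfl⟩
      · exact (ho ⟨q, hq, rfl⟩).elim
      · obtain rfl : p = last := Nat.succ_injective (hp'.trans (hlast.trans (sq k)).symm)
        exact ⟨rfl, rfl, fun hd => hu (congrArg h.embedding hd).symm⟩ }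
  have := happ.narrowPrefix_image_ne fun hmem => hmem rfl
  rwa [← h.compl_embedding_eq] at this

theorem compl_path (h : Linked G k l e e' z) {i : ℕ} (hi : 1 ≤ i) (hil : i ≤ l) :
    {z i}ᶜ = e '' Set.Iio (k * k) ∪ z '' Set.Icc 1 (i - 1) ∪ e' '' Set.Iio (k * k) ∪
      (fun j => z (l + 1 - j)) '' Set.Icc 1 (l - i) := by
  ext v
  constructor
  · intro hv
    rcases h.cover v with ⟨p, hp, rfl⟩ | ⟨p, hp, rfl⟩ | ⟨j, hj, hjl, rfl⟩
    · exact Or.inl (Or.inl (Or.inl ⟨p, hp, rfl⟩))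
    · exact Or.inl (Or.inr ⟨p, hp, rfl⟩)
    · rcases Nat.lt_trichotomy j i with hji | rfl | hij
      · exact Or.inl (Or.inl (Or.inr ⟨j, ⟨hj, by omega⟩, rfl⟩))
      · exact (hv rfl).elim
      · exact Or.inr ⟨l + 1 - j, ⟨by omega, by omega⟩, by simp only; congr 1; omega⟩
  · rintro (((⟨p, hp, rfl⟩ | ⟨j, ⟨hj, hji⟩, rfl⟩) | ⟨p, hp, rfl⟩) | ⟨j, ⟨hj, hji⟩, rfl⟩) hv
    · exact h.ne i hi hil p hp hv.symm
    · have := h.inj_path j hj (by omega) i hi hil hv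
      omega
    · exact h.ne' i hi hil p hp hv.symm
    · have := h.inj_path _ (by omega) (by omega) i hi hil hv
      omega

theorem finished_of_mem_side (h : Linked G k l e e' z) (hk : 0 < k) {i : ℕ} (hil : i ≤ l) {o : V}
    (ho : o ∈ e '' Set.Iio (k * k) ∪ z '' Set.Icc 1 (i - 1)) (hi : 1 ≤ i) :
    Finished G {z i}ᶜ (e '' Set.Iio (k * k) ∪ z '' Set.Icc 1 (i - 1)) o := by
  have mem_path : ∀ j < i, z j ∈ e '' Set.Iio (k * k) ∪ z '' Set.Icc 1 (i - 1) := fun j hj => by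
    rcases Nat.eq_zero_or_pos j with rfl | hj0
    · exact Or.inl ⟨_, Nat.sub_one_lt (Nat.mul_pos hk hk).ne', h.first.symm⟩
    · exact Or.inr ⟨j, ⟨hj0, by omega⟩, rfl⟩
  intro u hu huO hadj
  have ne_path : ∀ j ≤ i, u ≠ z j := fun j hj huj => by
    rcases Nat.lt_or_eq_of_le hj with hji | rfl
    · exact huO (huj ▸ mem_path j hji)
    · exact hu huj
  rcases ho with ⟨p, hp, rfl⟩ | ⟨j, ⟨hj, hji⟩, rfl⟩
  · rcases h.out p hp u hadj with ⟨q, hq, rfl⟩ | ⟨-, huz⟩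
    · exact huO (Or.inl ⟨q, hq, rfl⟩)
    · exact ne_path 1 hi huz
  · exact (h.out_path j hj (by omega) u hadj).elim (ne_path _ (by omega))
      (ne_path _ (by omega))

theorem narrowPrefix_compl_path (h : Linked G k l e e' z) (hk : 3 ≤ k) {i : ℕ} (hi : 1 ≤ i)
    (hil : i ≤ l) : NarrowPrefix k G {z i}ᶜ {z i}ᶜ := by
  have ne_path : ∀ j, 1 ≤ j → j ≤ l → j ≠ i → z j ≠ z i := fun j hj hjl hji hzj =>
    hji (h.inj_path j hj hjl i hi hil hzj)
  have hOut : NarrowPrefix k G {z i}ᶜ (e '' Set.Iio (k * k) ∪ z '' Set.Icc 1 (i - 1)) := by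
    have := h.narrowPrefix_union_path (W := {z i}ᶜ) (r := i - 1) hk (by omega)
      (fun p hp => (h.ne i hi hil p hp).symm)
      (fun j hj hji => ne_path j hj (by omega) (by omega))
      .empty (fun _ _ => Set.notMem_empty _) fun o ho => ho.elim
    rwa [Set.empty_union] at this
  have := h.symm.narrowPrefix_union_path (W := {z i}ᶜ) (r := l - i) hk (by omega)
    (fun p hp => (h.ne' i hi hil p hp).symm)
    (fun j hj hji => ne_path _ (by omega) (by omega) (by omega)) hOut ?_
    fun o ho => h.finished_of_mem_side (by omega) hil ho hi
  · rwa [← h.compl_path hi hil] at this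
  · rintro p hp (⟨q, hq, hpq⟩ | ⟨j, ⟨hj, hji⟩, hpj⟩)
    · exact h.disjoint q hq p hp hpq
    · exact h.ne' j hj (by omega) p hp hpj

theorem narrowPrefix_compl (h : Linked G k l e e' z) (hk : 3 ≤ k) (d : V) :
    NarrowPrefix k G {d}ᶜ {d}ᶜ := by
  rcases h.cover d with ⟨p, hp, rfl⟩ | ⟨p, hp, rfl⟩ | ⟨i, hi, hil, rfl⟩
  · exact h.narrowPrefix_compl_embedding hk hp
  · exact h.symm.narrowPrefix_compl_embedding hk hp
  · exact h.narrowPrefix_compl_path hk hi hil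

theorem lcwd_induce_le (h : Linked G k l e e' z) (hk : 3 ≤ k) {s : Set V} (hs : s ≠ Set.univ) :
    lcwd (G.induce s) ≤ ((k + 1 : ℕ) : ℕ∞) := by
  obtain ⟨d, hd⟩ := (Set.ne_univ_iff_exists_notMem s).1 hs
  exact lcwd_le ((h.narrowPrefix_compl hk d).hasLinearExpr (Set.subset_compl_singleton_iff.2 hd))

end UpperBound

end Linked

end Linked

section MGraph

variable {k l : ℕ}

theorem MGraph_adj_left {i j : Fin (k ^ 2)} :
    (MGraph k l).Adj (Sum.inl i) (Sum.inl j) ↔ (pathPower k (k ^ 2)).Adj i j := by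
  simp [MGraph, linkRel]

theorem MGraph_adj_right {i j : Fin (k ^ 2)} :
    (MGraph k l).Adj (Sum.inr (Sum.inl i)) (Sum.inr (Sum.inl j)) ↔
      (pathPower k (k ^ 2)).Adj i j := by
  simp [MGraph, linkRel]

theorem MGraph_adj_left_right {i j : Fin (k ^ 2)} :
    (MGraph k l).Adj (Sum.inl i) (Sum.inr (Sum.inl j)) ↔
      l = 0 ∧ i.val + 1 = k ^ 2 ∧ j.val + 1 = k ^ 2 := by
  simp [MGraph, linkRel]

theorem MGraph_adj_left_path {i : Fin (k ^ 2)} {t : Fin l} :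
    (MGraph k l).Adj (Sum.inl i) (Sum.inr (Sum.inr t)) ↔ i.val + 1 = k ^ 2 ∧ t.val = 0 := by
  simp [MGraph, linkRel]

theorem MGraph_adj_right_path {i : Fin (k ^ 2)} {t : Fin l} :
    (MGraph k l).Adj (Sum.inr (Sum.inl i)) (Sum.inr (Sum.inr t)) ↔
      i.val + 1 = k ^ 2 ∧ t.val + 1 = l := by
  simp [MGraph, linkRel]

theorem MGraph_adj_path {s t : Fin l} :
    (MGraph k l).Adj (Sum.inr (Sum.inr s)) (Sum.inr (Sum.inr t)) ↔
      s.val + 1 = t.val ∨ t.val + 1 = s.val := by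
  simp only [MGraph, pathPower, ne_eq, Fin.ext_iff, SimpleGraph.sup_adj, SimpleGraph.sum_adj,
    SimpleGraph.fromRel_adj, Sum.inr.injEq, linkRel, or_self, and_false, or_false]
  omega

/-- The vertex at position `p` of the layout of a path power; positions are read modulo `k ^ 2`. -/
def layout (k : ℕ) [NeZero k] (p : ℕ) : Fin (k ^ 2) := Fin.ofNat (k ^ 2) p

/-- The path from the last vertex of the one path power to that of the other. -/
def linkPath (k l : ℕ) [NeZero k] (i : ℕ) : Fin (k ^ 2) ⊕ (Fin (k ^ 2) ⊕ Fin l) :=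
  if i = 0 then Sum.inl (layout k (k * k - 1))
  else if h : i - 1 < l then Sum.inr (Sum.inr ⟨i - 1, h⟩)
  else Sum.inr (Sum.inl (layout k (k * k - 1)))

variable [NeZero k]

theorem val_layout {p : ℕ} (hp : p < k * k) : (layout k p).val = p :=
  Nat.mod_eq_of_lt (sq k ▸ hp)

theorem layout_val (i : Fin (k ^ 2)) : layout k i.val = i := Fin.ofNat_val_eq_self i

theorem eq_layout_last {i : Fin (k ^ 2)} (hi : i.val + 1 = k ^ 2) : i = layout k (k * k - 1) := by
  rw [← Nat.eq_sub_of_add_eq (hi.trans (sq k)), layout_val]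

theorem val_layout_last : (layout k (k * k - 1)).val + 1 = k ^ 2 := by
  have hpos : 0 < k * k := Nat.mul_pos (NeZero.pos k) (NeZero.pos k)
  rw [val_layout (Nat.sub_one_lt hpos.ne'), Nat.sub_add_cancel hpos, sq]

theorem layout_inj {p q : ℕ} (hp : p < k * k) (hq : q < k * k) (h : layout k p = layout k q) :
    p = q := by
  rw [← val_layout hp, h, val_layout hq]

theorem pathPower_adj_layout {p q : ℕ} (hp : p < k * k) (hq : q < k * k) :
    (pathPower k (k ^ 2)).Adj (layout k p) (layout k q) ↔ p ≠ q ∧ Close k p q := by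
  change layout k p ≠ layout k q ∧ Close k (layout k p) (layout k q) ↔ _
  rw [val_layout hp, val_layout hq]
  exact and_congr_left' (not_congr ⟨layout_inj hp hq, fun h => h ▸ rfl⟩)

theorem linkPath_zero : linkPath k l 0 = Sum.inl (layout k (k * k - 1)) := rfl

theorem linkPath_succ (t : Fin l) : linkPath k l (t.val + 1) = Sum.inr (Sum.inr t) :=
  (if_neg t.val.succ_ne_zero).trans (dif_pos t.2)

theorem linkPath_last : linkPath k l (l + 1) = Sum.inr (Sum.inl (layout k (k * k - 1))) :=
  (if_neg l.succ_ne_zero).trans (dif_neg (lt_irrefl l))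

theorem exists_linkPath_eq {i : ℕ} (hi : 1 ≤ i) (hil : i ≤ l) :
    ∃ t : Fin l, t.val + 1 = i ∧ linkPath k l i = Sum.inr (Sum.inr t) := by
  obtain ⟨i, rfl⟩ := Nat.exists_eq_add_of_le' hi
  exact ⟨⟨i, hil⟩, rfl, linkPath_succ ⟨i, hil⟩⟩

theorem MGraph_adj_linkPath_succ {i : ℕ} (hi : i ≤ l) :
    (MGraph k l).Adj (linkPath k l i) (linkPath k l (i + 1)) := by
  rcases Nat.eq_zero_or_pos i with rfl | hi0
  · rw [linkPath_zero]
    rcases Nat.eq_zero_or_pos l with rfl | hl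
    · rw [linkPath_last, MGraph_adj_left_right]
      exact ⟨rfl, val_layout_last, val_layout_last⟩
    · obtain ⟨t, ht, hzt⟩ := exists_linkPath_eq (k := k) le_rfl hl
      rw [zero_add, hzt, MGraph_adj_left_path]
      exact ⟨val_layout_last, Nat.succ_injective ht⟩
  · obtain ⟨t, ht, hzt⟩ := exists_linkPath_eq (k := k) hi0 hi
    rw [hzt]
    rcases Nat.lt_or_eq_of_le hi with hil | rfl
    · obtain ⟨s, hs, hzs⟩ := exists_linkPath_eq (k := k) i.succ_pos hil
      rw [hzs, MGraph_adj_path]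
      omega
    · rw [linkPath_last, SimpleGraph.adj_comm, MGraph_adj_right_path]
      exact ⟨val_layout_last, ht⟩

theorem eq_of_MGraph_adj_left {p : ℕ} (hp : p < k * k) {v}
    (h : (MGraph k l).Adj (Sum.inl (layout k p)) v) :
    (∃ q < k * k, v = Sum.inl (layout k q)) ∨ p + 1 = k * k ∧ v = linkPath k l 1 := by
  rcases v with i | i | t
  · exact Or.inl ⟨i, sq k ▸ i.2, by rw [layout_val]⟩
  · obtain ⟨rfl, hp', hi⟩ := MGraph_adj_left_right.1 h
    rw [val_layout hp, sq] at hp'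
    exact Or.inr ⟨hp', by rw [eq_layout_last hi, ← linkPath_last]⟩
  · obtain ⟨hp', ht⟩ := MGraph_adj_left_path.1 h
    rw [val_layout hp, sq] at hp'
    exact Or.inr ⟨hp', by rw [← linkPath_succ, ht]⟩

theorem eq_of_MGraph_adj_right {p : ℕ} (hp : p < k * k) {v}
    (h : (MGraph k l).Adj (Sum.inr (Sum.inl (layout k p))) v) :
    (∃ q < k * k, v = Sum.inr (Sum.inl (layout k q))) ∨ p + 1 = k * k ∧ v = linkPath k l l := by
  rcases v with i | i | t
  · obtain ⟨rfl, hi, hp'⟩ := MGraph_adj_left_right.1 h.symm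
    rw [val_layout hp, sq] at hp'
    exact Or.inr ⟨hp', by rw [eq_layout_last hi, ← linkPath_zero]⟩
  · exact Or.inl ⟨i, sq k ▸ i.2, by rw [layout_val]⟩
  · obtain ⟨hp', ht⟩ := MGraph_adj_right_path.1 h
    rw [val_layout hp, sq] at hp'
    exact Or.inr ⟨hp', by rw [← linkPath_succ, ht]⟩

theorem eq_of_MGraph_adj_path (t : Fin l) {v} (h : (MGraph k l).Adj (Sum.inr (Sum.inr t)) v) :
    v = linkPath k l t ∨ v = linkPath k l (t + 2) := by
  rcases v with i | i | s
  · obtain ⟨hi, ht⟩ := MGraph_adj_left_path.1 h.symm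
    exact Or.inl (by rw [ht, linkPath_zero, eq_layout_last hi])
  · obtain ⟨hi, ht⟩ := MGraph_adj_right_path.1 h.symm
    exact Or.inr (by rw [show t.val + 2 = l + 1 by omega, linkPath_last, eq_layout_last hi])
  · rcases MGraph_adj_path.1 h with hts | hst
    · exact Or.inr (by rw [← linkPath_succ s, ← hts])
    · exact Or.inl (by rw [← linkPath_succ s, hst])

variable (k l) in
theorem linked_MGraph : Linked (MGraph k l) k l (fun p => Sum.inl (layout k p))
    (fun p => Sum.inr (Sum.inl (layout k p))) (linkPath k l) where
  inj _ hp _ hq h := layout_inj hp hq (Sum.inl_injective h)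
  inj' _ hp _ hq h := layout_inj hp hq (Sum.inl_injective (Sum.inr_injective h))
  inj_path i hi hil j hj hjl h := by
    obtain ⟨s, hs, hzs⟩ := exists_linkPath_eq (k := k) hi hil
    obtain ⟨t, ht, hzt⟩ := exists_linkPath_eq (k := k) hj hjl
    rw [hzs, hzt] at h
    rw [← hs, ← ht, Sum.inr_injective (Sum.inr_injective h)]
  disjoint _ _ _ _ := Sum.inl_ne_inr
  ne i hi hil p _ := by
    obtain ⟨t, -, hzt⟩ := exists_linkPath_eq (k := k) hi hil
    exact hzt ▸ Sum.inr_ne_inl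
  ne' i hi hil p _ h := by
    obtain ⟨t, -, hzt⟩ := exists_linkPath_eq (k := k) hi hil
    exact Sum.inr_ne_inl (Sum.inr_injective (hzt ▸ h))
  cover := by
    rintro (p | p | t)
    · exact Or.inl ⟨p, sq k ▸ p.2, by rw [layout_val]⟩
    · exact Or.inr (Or.inl ⟨p, sq k ▸ p.2, by rw [layout_val]⟩)
    · exact Or.inr (Or.inr ⟨t + 1, t.val.succ_pos, t.2, (linkPath_succ t).symm⟩)
  first := linkPath_zero
  last := linkPath_last
  adj _ hp _ hq := MGraph_adj_left.trans (pathPower_adj_layout hp hq)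
  adj' _ hp _ hq := MGraph_adj_right.trans (pathPower_adj_layout hp hq)
  adj_path _ := MGraph_adj_linkPath_succ
  out _ hp _ := eq_of_MGraph_adj_left hp
  out' _ hp _ := eq_of_MGraph_adj_right hp
  out_path i hi hil v h := by
    obtain ⟨t, rfl, hzt⟩ := exists_linkPath_eq (k := k) hi hil
    exact eq_of_MGraph_adj_path t (hzt ▸ h)

end MGraph

section Spread

variable {k n c g : ℕ} {T : ℕ → Prop}

/-- Some position `u < n` outside `T` is within distance `k` of just one of `a` and `b`. -/
def Separated (k n : ℕ) (T : ℕ → Prop) (a b : ℕ) : Prop :=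
  ∃ u < n, ¬ T u ∧ ¬ (Close k a u ↔ Close k b u)

/-- The positions in `A ⊆ T` have pairwise different neighbourhoods outside `T`, none of which is
contained in the last position. -/
structure Spread (k n : ℕ) (T : ℕ → Prop) (A : Finset ℕ) : Prop where
  lt : ∀ a ∈ A, a < n
  mem : ∀ a ∈ A, T a
  exists_close : ∀ a ∈ A, ∃ u, u + 1 < n ∧ ¬ T u ∧ Close k a u
  separated : ∀ a ∈ A, ∀ b ∈ A, a < b → Separated k n T a b

theorem exists_mod_eq (hc : c < k) (g : ℕ) : ∃ u, g ≤ u ∧ u < g + k ∧ u % k = c := by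
  have hg := Nat.mod_lt g (by omega : k > 0)
  have hr := Nat.mod_lt (k - g % k + c) (by omega : k > 0)
  refine ⟨g + (k - g % k + c) % k, by omega, by omega, ?_⟩
  rw [Nat.add_mod_mod, ← Nat.mod_add_mod, show g % k + (k - g % k + c) = c + k by omega,
    Nat.add_mod_right, Nat.mod_eq_of_lt hc]

theorem exists_close_notMem (hn : 2 * k < n) (hc : c < k)
    (hC : ∀ p, p + 1 < n → p % k = c → ¬ T p) {a : ℕ} (ha : a < n) :
    ∃ u, u + 1 < n ∧ ¬ T u ∧ Close k a u := by
  obtain ⟨u, hu, hu', huc⟩ := exists_mod_eq hc (a - k)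
  have hu1 : u + 1 < n := by omega
  exact ⟨u, hu1, hC u hu1 huc, by unfold Close; omega⟩

theorem separated_of_mod_eq (hn : 2 * k < n) (hc : c < k)
    (hC : ∀ p, p + 1 < n → p % k = c → ¬ T p) {a u b : ℕ} (hau : a < u) (hub : u < b)
    (hb : b < n) (huc : u % k = c) : Separated k n T a b := by
  obtain ⟨v, hav, hva, hvc⟩ := exists_mod_eq hc (a + 1)
  have hvb : v < b := by
    by_contra hbv
    have hlt : v - u < k := by omega
    have hmod : (v - u) % k = 0 := Nat.sub_mod_eq_zero_of_mod_eq (hvc.trans huc.symm)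
    rw [Nat.mod_eq_of_lt hlt] at hmod
    omega
  rcases le_or_gt k v with hkv | hvk
  · refine ⟨v - k, by omega, hC _ (by omega) ?_, by unfold Close; omega⟩
    rw [← Nat.mod_eq_sub_mod hkv, hvc]
  rcases le_or_gt b (v + k) with hbv | hvb'
  · refine ⟨v + k, by omega, hC _ (by omega) ?_, by unfold Close; omega⟩
    rw [Nat.add_mod_right, hvc]
  · exact ⟨v, by omega, hC v (by omega) hvc, by unfold Close; omega⟩

/-- `r` is the element of `T` in its residue class that is next to the gap `[g, g + k)`. -/
def NextToGap (k n g : ℕ) (T : ℕ → Prop) (r : ℕ) : Prop :=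
  T r ∧ r < n ∧ ((r < g ∧ ¬ T (r + k)) ∨ (g + k ≤ r ∧ ¬ T (r - k)))

theorem exists_nextToGap (hk : 0 < k) (hg : g + k ≤ n)
    (hgap : ∀ p, g ≤ p → p < g + k → ¬ T p) {p : ℕ} (hp : p < n) (hT : T p) :
    ∃ r, NextToGap k n g T r ∧ r % k = p % k ∧ (p + 1 < n → r + 1 < n) := by
  have outside : ∀ p, T p → p < g ∨ g + k ≤ p := fun p hT => by
    by_contra h
    exact hgap p (by omega) (by omega) hT
  rcases outside p hT with h | h
  · induction hm : g - p using Nat.strong_induction_on generalizing p with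
    | _ m ih =>
      by_cases hT' : T (p + k)
      · have := outside _ hT'
        obtain ⟨r, hr, hmod, hlt⟩ := ih (g - (p + k)) (by omega) (p := p + k) (by omega) hT'
          (by omega) rfl
        exact ⟨r, hr, by rw [hmod, Nat.add_mod_right], fun _ => hlt (by omega)⟩
      · exact ⟨p, ⟨hT, hp, Or.inl ⟨h, hT'⟩⟩, rfl, id⟩
  · induction p using Nat.strong_induction_on with
    | _ p ih =>
      by_cases hT' : T (p - k)
      · have := outside _ hT'
        obtain ⟨r, hr, hmod, hlt⟩ := ih (p - k) (by omega) (by omega) hT' (by omega)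
        refine ⟨r, hr, ?_, fun _ => hlt (by omega)⟩
        rw [hmod, ← Nat.mod_eq_sub_mod (by omega)]
      · exact ⟨p, ⟨hT, hp, Or.inr ⟨h, hT'⟩⟩, rfl, id⟩

theorem NextToGap.separated (hn : 2 * k < n) (hc : c < k)
    (hC : ∀ p, p + 1 < n → p % k = c → ¬ T p) (hg : g + k ≤ n)
    (hgap : ∀ p, g ≤ p → p < g + k → ¬ T p) {a b : ℕ} (ha : NextToGap k n g T a) (hab : a < b)
    (hb : NextToGap k n g T b ∨ b = n - 1 ∧ T b) : Separated k n T a b := by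
  have across : a < g → g + k ≤ b → b < n → Separated k n T a b := fun hag hbg hbn => by
    obtain ⟨u, hgu, hug, huc⟩ := exists_mod_eq hc g
    exact separated_of_mod_eq hn hc hC (by omega) (by omega) hbn huc
  obtain ⟨-, -, ⟨hag, -⟩ | ⟨hag, hTa⟩⟩ := ha
  · rcases hb with ⟨-, hbn, ⟨hbg, hTb⟩ | ⟨hbg, -⟩⟩ | ⟨rfl, hT⟩
    · exact ⟨b + k, by omega, hTb, by unfold Close; omega⟩
    · exact across hag hbg hbn
    · refine across hag ?_ (by omega)
      by_contra h
      exact hgap _ (by omega) (by omega) hT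
  · have hbn : b < n := by
      rcases hb with hb | ⟨rfl, -⟩
      · exact hb.2.1
      · omega
    exact ⟨a - k, by omega, hTa, by unfold Close; omega⟩

theorem exists_separated_of_gap (hn : 2 * k < n) (hc : c < k)
    (hC : ∀ p, p + 1 < n → p % k = c → ¬ T p)
    (hQ : ∀ q < k, q ≠ c → ∃ p < n, T p ∧ p % k = q) (hg : g + k ≤ n)
    (hgap : ∀ p, g ≤ p → p < g + k → ¬ T p) :
    ∃ A : Finset ℕ, A.card = k - 1 ∧ (∀ a ∈ A, a < n ∧ T a) ∧
      (∀ a ∈ A, ∀ b, b ∈ A ∨ b = n - 1 ∧ T b → a < b → Separated k n T a b) ∧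
      ((c ≠ (n - 1) % k → ∃ p, p + 1 < n ∧ T p ∧ p % k = (n - 1) % k) →
        ∀ a ∈ A, a + 1 < n) := by
  classical
  have hrep : ∀ q ∈ (Finset.range k).erase c, ∃ r, NextToGap k n g T r ∧ r % k = q ∧
      ((∃ p, p + 1 < n ∧ T p ∧ p % k = q) → r + 1 < n) := by
    intro q hq
    by_cases h : ∃ p, p + 1 < n ∧ T p ∧ p % k = q
    · obtain ⟨p, hp, hT, hpq⟩ := h
      obtain ⟨r, hr, hmod, hlt⟩ := exists_nextToGap (by omega) hg hgap (by omega : p < n) hT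
      exact ⟨r, hr, hmod.trans hpq, fun _ => hlt hp⟩
    · rw [Finset.mem_erase, Finset.mem_range] at hq
      obtain ⟨p, hp, hT, hpq⟩ := hQ q hq.2 hq.1
      obtain ⟨r, hr, hmod, -⟩ := exists_nextToGap (by omega) hg hgap hp hT
      exact ⟨r, hr, hmod.trans hpq, fun h' => (h h').elim⟩
  choose! f hf hmod hlt using hrep
  refine ⟨((Finset.range k).erase c).image f, ?_, ?_, ?_, fun hcol => ?_⟩
  · rw [Finset.card_image_of_injOn fun q hq q' hq' h => by rw [← hmod q hq, ← hmod q' hq', h],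
      Finset.card_erase_of_mem (Finset.mem_range.2 hc), Finset.card_range]
  · exact Finset.forall_mem_image.2 fun q hq => ⟨(hf q hq).2.1, (hf q hq).1⟩
  · refine Finset.forall_mem_image.2 fun q hq b hb hab =>
      (hf q hq).separated hn hc hC hg hgap hab (hb.imp_left fun hb => ?_)
    obtain ⟨q', hq', rfl⟩ := Finset.mem_image.1 hb
    exact hf q' hq'
  · refine Finset.forall_mem_image.2 fun q hq => ?_
    by_contra hlast
    have hfq : f q = n - 1 := by have := (hf q hq).2.1; omega
    have hq' : (n - 1) % k = q := by rw [← hmod q hq, hfq]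
    refine hlast (hlt q hq ?_)
    rw [← hq']
    exact hcol fun hcn => Finset.ne_of_mem_erase hq (hq'.symm.trans hcn.symm)

theorem exists_separated_of_no_gap (hk : 3 ≤ k) (hc : c < k)
    (hC : ∀ p, p + 1 < k * k → p % k = c → ¬ T p)
    (hgap : ∀ g, g + k ≤ k * k → ∃ p, g ≤ p ∧ p < g + k ∧ T p) :
    ∃ A : Finset ℕ, A.card = k - 1 ∧ (∀ a ∈ A, a + 1 < k * k ∧ T a) ∧
      ∀ a ∈ A, ∀ b, b ∈ A ∨ b = k * k - 1 → a < b → Separated k (k * k) T a b := by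
  classical
  have hn : 2 * k < k * k := Nat.mul_lt_mul_of_pos_right (by omega) (by omega)
  obtain ⟨u, hu, hu', huc⟩ := exists_mod_eq hc (k - 1)
  have hmod : ∀ i, (u + i * k) % k = c := fun i => by rw [Nat.add_mul_mod_self_right, huc]
  have hend : ∀ i < k - 1, u + i * k + 1 < k * k := fun i hi => by
    have : (i + 2) * k ≤ k * k := Nat.mul_le_mul_right k (by omega)
    rw [Nat.add_mul] at this
    omega
  have hrep : ∀ i < k - 1, ∃ p, u + i * k < p + k ∧ p < u + i * k ∧ T p := fun i hi => by
    have := hend i hi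
    obtain ⟨p, hp, hp', hT⟩ := hgap (u + i * k - (k - 1)) (by omega)
    refine ⟨p, by omega, lt_of_le_of_ne (by omega) ?_, hT⟩
    rintro rfl
    exact hC _ this (hmod i) hT
  choose! f hf hf' hT using hrep
  have hmono : ∀ i j, i < j → j < k - 1 → u + i * k < f j := fun i j hij hj => by
    have : (i + 1) * k ≤ j * k := Nat.mul_le_mul_right k hij
    have := hf j hj
    rw [Nat.succ_mul] at *
    omega
  have hstrict : StrictMonoOn f (Finset.range (k - 1)) := fun i hi j hj hij =>
    (hf' i (Finset.mem_range.1 hi)).trans (hmono i j hij (Finset.mem_range.1 hj))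
  refine ⟨(Finset.range (k - 1)).image f, ?_, ?_, ?_⟩
  · rw [Finset.card_image_of_injOn hstrict.injOn, Finset.card_range]
  · refine Finset.forall_mem_image.2 fun i hi => ?_
    rw [Finset.mem_range] at hi
    exact ⟨(Nat.succ_lt_succ (hf' i hi)).trans (hend i hi), hT i hi⟩
  · refine Finset.forall_mem_image.2 fun i hi b hb hab => ?_
    have hi' := Finset.mem_range.1 hi
    have hlt : u + i * k < b ∧ b < k * k := by
      rcases hb with hb | rfl
      · obtain ⟨j, hj, rfl⟩ := Finset.mem_image.1 hb
        have hj' := Finset.mem_range.1 hj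
        exact ⟨hmono i j ((hstrict.lt_iff_lt hi hj).1 hab) hj',
          (hf' j hj').trans (Nat.lt_of_succ_lt (hend j hj'))⟩
      · have := hend i hi'
        omega
    exact separated_of_mod_eq hn hc hC (hf' i hi') hlt.1 hlt.2 (hmod i)

theorem mul_self_pred_mod (hk : 0 < k) : (k * k - 1) % k = k - 1 := by
  obtain ⟨m, rfl⟩ := Nat.exists_eq_succ_of_ne_zero hk.ne'
  rw [show m.succ * m.succ - 1 = m + m.succ * m by rw [Nat.mul_succ]; omega,
    Nat.add_mul_mod_self_left, Nat.mod_eq_of_lt m.lt_succ_self, Nat.succ_sub_one]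

theorem exists_card_separated (hk : 3 ≤ k) (hc : c < k)
    (hC : ∀ p, p + 1 < k * k → p % k = c → ¬ T p)
    (hQ : ∀ q < k, q ≠ c → ∃ p < k * k, T p ∧ p % k = q) :
    ∃ A : Finset ℕ, A.card = k - 1 ∧ (∀ a ∈ A, a < k * k ∧ T a) ∧
      (∀ a ∈ A, ∀ b, b ∈ A ∨ b = k * k - 1 ∧ T b → a < b → Separated k (k * k) T a b) ∧
      ((c ≠ k - 1 → ∃ p, p + 1 < k * k ∧ T p ∧ p % k = k - 1) → ∀ a ∈ A, a + 1 < k * k) := by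
  by_cases hgap : ∃ g, g + k ≤ k * k ∧ ∀ p, g ≤ p → p < g + k → ¬ T p
  · obtain ⟨g, hg, hgap⟩ := hgap
    have := exists_separated_of_gap (Nat.mul_lt_mul_of_pos_right (by omega) (by omega)) hc hC hQ
      hg hgap
    rwa [mul_self_pred_mod (by omega)] at this
  · push Not at hgap
    obtain ⟨A, hcard, hA, hsep⟩ := exists_separated_of_no_gap hk hc hC hgap
    exact ⟨A, hcard, fun a ha => ⟨Nat.lt_of_succ_lt (hA a ha).1, (hA a ha).2⟩,
      fun a ha b hb => hsep a ha b (hb.imp_right And.left), fun _ a ha => (hA a ha).1⟩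

theorem exists_spread (hk : 3 ≤ k) (hc : c < k) (hC : ∀ p, p + 1 < k * k → p % k = c → ¬ T p)
    (hQ : ∀ q < k, q ≠ c → ∃ p < k * k, T p ∧ p % k = q) :
    ∃ A : Finset ℕ, A.card = k - 1 ∧ Spread k (k * k) T A := by
  have hn : 2 * k < k * k := Nat.mul_lt_mul_of_pos_right (by omega) (by omega)
  obtain ⟨A, hcard, hA, hsep, -⟩ := exists_card_separated hk hc hC hQ
  exact ⟨A, hcard, fun a ha => (hA a ha).1, fun a ha => (hA a ha).2,
    fun a ha => exists_close_notMem hn hc hC (hA a ha).1, fun a ha b hb => hsep a ha b (Or.inl hb)⟩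

theorem exists_spread_of_last_mem (hk : 3 ≤ k) (hc : c < k)
    (hC : ∀ p, p + 1 < k * k → p % k = c → ¬ T p)
    (hQ : ∀ q < k, q ≠ c → ∃ p < k * k, T p ∧ p % k = q) (hT : T (k * k - 1))
    (hcol : c ≠ k - 1 → ∃ p, p + 1 < k * k ∧ T p ∧ p % k = k - 1) :
    ∃ A : Finset ℕ, A.card = k ∧ Spread k (k * k) T A := by
  classical
  have hn : 2 * k < k * k := Nat.mul_lt_mul_of_pos_right (by omega) (by omega)
  obtain ⟨A, hcard, hA, hsep, hlt⟩ := exists_card_separated hk hc hC hQ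
  replace hlt := hlt hcol
  have hinsert : ∀ a ∈ insert (k * k - 1) A, a < k * k ∧ T a := by
    rw [Finset.forall_mem_insert]
    exact ⟨⟨by omega, hT⟩, hA⟩
  refine ⟨insert (k * k - 1) A, ?_, fun a ha => (hinsert a ha).1, fun a ha => (hinsert a ha).2,
    fun a ha => exists_close_notMem hn hc hC (hinsert a ha).1, fun a ha b hb hab => ?_⟩
  · rw [Finset.card_insert_of_notMem fun h => by have := hlt _ h; omega, hcard]
    omega
  · rcases Finset.mem_insert.1 ha with rfl | ha
    · have := (hinsert b hb).1
      omega
    · refine hsep a ha b ?_ hab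
      rcases Finset.mem_insert.1 hb with rfl | hb
      · exact Or.inr ⟨rfl, hT⟩
      · exact Or.inl hb

theorem separated_of_extremal (hk : 3 ≤ k) {s t : ℕ} (hst : s < t) (ht : t < k * k)
    (hlow : ∀ v < s, ¬ T v) (hhigh : ∀ v < k * k, t < v → ¬ T v)
    (hproper : 0 < s ∨ t + 1 < k * k) : Separated k (k * k) T s t := by
  have hkk : k = 3 ∨ 4 * k ≤ k * k := by
    rcases Nat.lt_or_ge k 4 with h | h
    · exact Or.inl (by omega)
    · exact Or.inr (Nat.mul_le_mul_right k h)
  unfold Separated Close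
  by_cases hs : k ≤ s
  · exact ⟨s - k, by omega, hlow _ (by omega), by omega⟩
  by_cases htk : t + k < k * k
  · exact ⟨t + k, by omega, hhigh _ (by omega) (by omega), by omega⟩
  have hfar : s + k + 1 ≤ t := by
    rcases hkk with rfl | hkk <;> omega
  rcases hproper with hs0 | ht1
  · exact ⟨s - 1, by omega, hlow _ (by omega), by omega⟩
  · exact ⟨t + 1, by omega, hhigh _ (by omega) (by omega), by omega⟩

theorem exists_separated_of_endpoints (hk : 3 ≤ k) (h0 : T 0) (hlast : T (k * k - 1)) {u : ℕ}
    (hu : u < k * k) (hTu : ¬ T u) :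
    ∃ y < k * k, ∃ z < k * k, T y ∧ T z ∧ Separated k (k * k) T y z := by
  have hkk : k = 3 ∨ 4 * k ≤ k * k := by
    rcases Nat.lt_or_ge k 4 with h | h
    · exact Or.inl (by omega)
    · exact Or.inr (Nat.mul_le_mul_right k h)
  obtain ⟨v, hv, hTv, hTv'⟩ : ∃ v, v + 1 < k * k ∧ T v ∧ ¬ T (v + 1) := by
    by_contra! h
    have : ∀ v, v < k * k → T v := by
      intro v
      induction v with
      | zero => exact fun _ => h0
      | succ v ih => exact fun hv => h v hv (ih (by omega))
    exact hTu (this u hu)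
  by_cases hvk : v + 1 ≤ k
  · refine ⟨v, by omega, k * k - 1, by omega, hTv, hlast, v + 1, hv, hTv', ?_⟩
    unfold Close
    rcases hkk with rfl | hkk <;> omega
  · refine ⟨0, by omega, v, by omega, h0, hTv, v + 1, hv, hTv', ?_⟩
    unfold Close
    omega

theorem exists_separated (hk : 3 ≤ k) {a b u : ℕ} (ha : T a) (hb : T b) (hab : a < b)
    (hbn : b < k * k) (hu : u < k * k) (hTu : ¬ T u) :
    ∃ y < k * k, ∃ z < k * k, T y ∧ T z ∧ Separated k (k * k) T y z := by
  classical
  obtain ⟨s, hs, hsmin⟩ := Finset.exists_min_image ((Finset.range (k * k)).filter T) id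
    ⟨a, Finset.mem_filter.2 ⟨Finset.mem_range.2 (by omega), ha⟩⟩
  obtain ⟨t, ht, htmax⟩ := Finset.exists_max_image ((Finset.range (k * k)).filter T) id ⟨s, hs⟩
  simp only [Finset.mem_filter, Finset.mem_range, id] at hs hsmin ht htmax
  have hsa := hsmin a ⟨by omega, ha⟩
  have hbt := htmax b ⟨hbn, hb⟩
  by_cases hproper : 0 < s ∨ t + 1 < k * k
  · refine ⟨s, hs.1, t, ht.1, hs.2, ht.2, separated_of_extremal hk (by omega) ht.1
      (fun v hv hT => ?_) (fun v hv htv hT => ?_) hproper⟩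
    · exact (hsmin v ⟨by omega, hT⟩).not_gt hv
    · exact (htmax v ⟨hv, hT⟩).not_gt htv
  · obtain rfl : s = 0 := by omega
    obtain rfl : t = k * k - 1 := by omega
    exact exists_separated_of_endpoints hk hs.2 ht.2 hu hTu

end Spread

section MissingClass

variable {k c x : ℕ} {f : ℕ → ℕ}

/-- If the positions below `k * k` are reached in the order of the times `f`, then just before `x`
is reached, `c` is the only residue class modulo `k` without a position reached, where the last
position does not count as an element of the class `c`. -/
structure MissingClass (k : ℕ) (f : ℕ → ℕ) (c x : ℕ) : Prop where
  lt_modulus : c < k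
  lt : x < k * k
  le : ∀ p, p + 1 < k * k → p % k = c → f x ≤ f p
  exists_lt : ∀ q < k, q ≠ c → ∃ p < k * k, f p < f x ∧ p % k = q

theorem exists_missingClass (hk : 0 < k) (hf : Set.InjOn f (Set.Iio (k * k))) :
    ∃ x, MissingClass k f (x % k) x := by
  have hkk : k ≤ k * k := Nat.le_mul_self k
  have hmin : ∀ q < k, ∃ m < k * k, m % k = q ∧ ∀ p < k * k, p % k = q → f m ≤ f p := by
    intro q hq
    obtain ⟨m, hm, hle⟩ := Finset.exists_min_image ((Finset.range (k * k)).filter (· % k = q)) f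
      ⟨q, Finset.mem_filter.2 ⟨Finset.mem_range.2 (by omega), Nat.mod_eq_of_lt hq⟩⟩
    simp only [Finset.mem_filter, Finset.mem_range] at hm hle
    exact ⟨m, hm.1, hm.2, fun p hp hpq => hle p ⟨hp, hpq⟩⟩
  choose! m hm hmod hle using hmin
  obtain ⟨c, hc, hmax⟩ := Finset.exists_max_image (Finset.range k) (fun q => f (m q))
    ⟨0, Finset.mem_range.2 hk⟩
  simp only [Finset.mem_range] at hc hmax
  refine ⟨m c, Nat.mod_lt _ hk, hm c hc, fun p hp hpc => ?_, fun q hq hqc => ?_⟩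
  · exact hle c hc p (Nat.lt_of_succ_lt hp) (hpc.trans (hmod c hc))
  · refine ⟨m q, hm q hq, lt_of_le_of_ne (hmax q hq) fun h => hqc ?_, hmod q hq⟩
    rw [← hmod q hq, hf (hm q hq) (hm c hc) h]

namespace MissingClass

theorem exists_pair (h : MissingClass k f c x) (hk : 3 ≤ k) :
    ∃ a b, a < b ∧ b < k * k ∧ f a < f x ∧ f b < f x := by
  obtain ⟨q, q', hq, hq', hne, hqc, hqc'⟩ :
      ∃ q q', q < k ∧ q' < k ∧ q ≠ q' ∧ q ≠ c ∧ q' ≠ c := by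
    rcases (by omega : c = 0 ∨ c = 1 ∨ 2 ≤ c) with rfl | rfl | hc
    · exact ⟨1, 2, by omega⟩
    · exact ⟨0, 2, by omega⟩
    · exact ⟨0, 1, by omega⟩
  obtain ⟨a, ha, hax, rfl⟩ := h.exists_lt q hq hqc
  obtain ⟨b, hb, hbx, rfl⟩ := h.exists_lt q' hq' hqc'
  rcases lt_trichotomy a b with hab | rfl | hab
  · exact ⟨a, b, hab, hb, hax, hbx⟩
  · exact (hne rfl).elim
  · exact ⟨b, a, hab, ha, hbx, hax⟩

theorem exists_spread (h : MissingClass k f c x) (hk : 3 ≤ k) :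
    ∃ A : Finset ℕ, A.card = k - 1 ∧ Spread k (k * k) (fun p => f p < f x) A :=
  LinCW.exists_spread hk h.lt_modulus (fun p hp hpc => (h.le p hp hpc).not_gt) h.exists_lt

theorem exists_next (h : MissingClass k f (x % k) x) (hf : Set.InjOn f (Set.Iio (k * k)))
    (hk : 3 ≤ k) (hx : x % k ≠ k - 1) (hcol : ∀ p, p + 1 < k * k → f p < f x → p % k ≠ k - 1) :
    ∃ w, f x < f w ∧ MissingClass k f (k - 1) w := by
  have hkk : 3 * k ≤ k * k := Nat.mul_le_mul_right k hk
  have late : ∀ p, p + 1 < k * k → p % k = k - 1 → f x < f p := fun p hp hpk => by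
    refine lt_of_le_of_ne (not_lt.1 fun hpx => hcol p hp hpx hpk) fun hxp => hx ?_
    rw [hf h.lt (Nat.lt_of_succ_lt hp) hxp, hpk]
  obtain ⟨w, hw, hmin⟩ := Finset.exists_min_image
    ((Finset.range (k * k)).filter fun p => f x < f p) f
    ⟨k - 1, Finset.mem_filter.2 ⟨Finset.mem_range.2 (by omega),
      late _ (by omega) (Nat.mod_eq_of_lt (by omega))⟩⟩
  simp only [Finset.mem_filter, Finset.mem_range] at hw hmin
  refine ⟨w, hw.2, by omega, hw.1, fun p hp hpk => hmin p ⟨by omega, late p hp hpk⟩, ?_⟩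
  intro q hq _
  by_cases hqx : q = x % k
  · exact ⟨x, h.lt, hw.2, hqx.symm⟩
  · obtain ⟨p, hp, hpx, hpq⟩ := h.exists_lt q hq hqx
    exact ⟨p, hp, hpx.trans hw.2, hpq⟩

theorem exists_spread_of_last_lt (h : MissingClass k f (x % k) x)
    (hf : Set.InjOn f (Set.Iio (k * k))) (hk : 3 ≤ k) (hlast : f (k * k - 1) < f x) :
    ∃ c w, MissingClass k f c w ∧ f x ≤ f w ∧
      ∃ A : Finset ℕ, A.card = k ∧ Spread k (k * k) (fun p => f p < f w) A := by
  have spread : ∀ {c w}, MissingClass k f c w → f x ≤ f w →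
      (c ≠ k - 1 → ∃ p, p + 1 < k * k ∧ f p < f w ∧ p % k = k - 1) →
      ∃ A : Finset ℕ, A.card = k ∧ Spread k (k * k) (fun p => f p < f w) A := fun hw hxw hcol =>
    exists_spread_of_last_mem hk hw.lt_modulus (fun p hp hpc => (hw.le p hp hpc).not_gt)
      hw.exists_lt (hlast.trans_le hxw) hcol
  by_cases hcol : x % k ≠ k - 1 → ∃ p, p + 1 < k * k ∧ f p < f x ∧ p % k = k - 1
  · exact ⟨_, x, h, le_rfl, spread h le_rfl hcol⟩
  · push Not at hcol
    obtain ⟨w, hxw, hw⟩ := h.exists_next hf hk hcol.1 hcol.2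
    exact ⟨_, w, hw, hxw.le, spread hw hxw.le fun hne => (hne rfl).elim⟩

end MissingClass

end MissingClass

section LowerBound

variable {V : Type*} {G : SimpleGraph V} {k l c : ℕ} {e e' z : ℕ → V} {τ : V → ℕ}

namespace Linked

theorem path_ne (h : Linked G k l e e' z) {i : ℕ} (hi : i ≤ l) {p : ℕ} (hp : p < k * k) :
    z i ≠ e' p := by
  rcases Nat.eq_zero_or_pos i with rfl | hi0
  · rw [h.first]
    exact h.disjoint _ (by omega) _ hp
  · exact h.ne' i hi0 hi p hp

theorem not_adj_of_ne (h : Linked G k l e e' z) {v : V} (hv : ∀ p < k * k, v ≠ e' p) {p : ℕ}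
    (hp : p < k * k) (hvz : v ≠ z l ∨ p + 1 < k * k) : ¬ G.Adj v (e' p) := by
  intro hadj
  rcases h.out' p hp v hadj.symm with ⟨q, hq, rfl⟩ | ⟨hp', rfl⟩
  · exact hv q hq rfl
  · exact hvz.elim (fun h => h rfl) fun h => h.ne hp'

theorem adj_path_last (h : Linked G k l e e' z) : G.Adj (z l) (e' (k * k - 1)) :=
  h.last ▸ h.adj_path l le_rfl

theorem exists_eq_of_shares (h : Linked G k l e e' z) (hk : 3 ≤ k) {p : ℕ} (hp : p < k * k)
    {y : V} (hy : Shares G τ (e' p) y) : ∃ q < k * k, y = e' q := by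
  have hkk : 3 * k ≤ k * k := Nat.mul_le_mul_right k hk
  obtain ⟨u, hu, hne, hclose⟩ : ∃ u, u + 1 < k * k ∧ p ≠ u ∧ Close k p u := by
    unfold Close
    by_cases hp' : p + 2 < k * k
    · exact ⟨p + 1, by omega⟩
    · exact ⟨p - 1, by omega⟩
  by_contra! hne'
  exact h.not_adj_of_ne hne' (by omega) (Or.inr hu)
    (hy.2.2.1 _ ((h.adj' p hp u (by omega)).2 ⟨hne, hclose⟩))

theorem eq_zero_of_shares (h : Linked G k l e e' z) (hk : 3 ≤ k) {p q : ℕ} (hp : p < k * k)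
    (hq : q < k * k) (hpq : Shares G τ (e' p) (e' q)) : p = 0 ∧ q = k + 1 := by
  have : 3 * k ≤ k * k := Nat.mul_le_mul_right k hk
  obtain ⟨hlt, hnadj, hsub, -⟩ := hpq
  have hqp : q ≠ p := by
    rintro rfl
    exact lt_irrefl _ hlt
  have hfar : ¬ Close k p q := fun hclose => hnadj ((h.adj' p hp q hq).2 ⟨hqp.symm, hclose⟩)
  have hclose : ∀ u < k * k, p ≠ u → Close k p u → Close k q u := fun u hu hne hpu =>
    ((h.adj' q hq u hu).1 (hsub _ ((h.adj' p hp u hu).2 ⟨hne, hpu⟩))).2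
  unfold Close at hfar hclose
  rcases lt_or_gt_of_ne hqp with hqp | hpq
  · exfalso
    have hlast : k * k - 1 = p := by
      by_contra hne
      have := hclose (p + 1) (by omega) (by omega) (by omega)
      omega
    have hadj : G.Adj (e' p) (z l) := hlast ▸ h.adj_path_last.symm
    exact h.not_adj_of_ne (fun _ => h.path_ne le_rfl) hq (Or.inr (by omega)) (hsub _ hadj).symm
  · have hp0 : p = 0 := by
      by_contra hne
      have := hclose (p - 1) (by omega) (by omega) (by omega)
      omega
    have := hclose (p + 1) (by omega) (by omega) (by omega)
    omega

theorem not_shares (h : Linked G k l e e' z) (hk : 3 ≤ k) (hτ : Function.Injective τ) {x : ℕ}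
    (hx : MissingClass k (fun p => τ (e' p)) c x) (y : V) : ¬ Shares G τ (e' x) y := by
  intro hy
  have hkk : 3 * k ≤ k * k := Nat.mul_le_mul_right k hk
  obtain ⟨q, hq, rfl⟩ := h.exists_eq_of_shares hk hx.lt hy
  obtain ⟨rfl, rfl⟩ := h.eq_zero_of_shares hk hx.lt hq hy
  obtain ⟨u, hu, hu', huc⟩ := exists_mod_eq hx.lt_modulus (k + 1)
  have hxu : τ (e' 0) ≤ τ (e' u) := hx.le u (by omega) huc
  rcases eq_or_ne u (k + 1) with rfl | hne
  · exact hxu.not_gt hy.1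
  have hxu' : τ (e' 0) ≠ τ (e' u) := fun heq => by
    have := h.inj' 0 hx.lt u (by omega) (hτ heq)
    omega
  have hadj := hy.2.2.2 (e' u) (lt_of_le_of_ne hxu hxu')
    ((h.adj' _ hq u (by omega)).2 ⟨hne.symm, by unfold Close; omega⟩)
  have := ((h.adj' 0 hx.lt u (by omega)).1 hadj).2
  unfold Close at this
  omega

section Spread

variable {x : V} {A : Finset ℕ}

theorem adj_iff_close_of_spread (h : Linked G k l e e' z)
    (hA : Spread k (k * k) (fun p => τ (e' p) < τ x) A) {a : ℕ} (ha : a ∈ A) {u : ℕ}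
    (hu : u < k * k) (hux : ¬ τ (e' u) < τ x) : G.Adj (e' a) (e' u) ↔ Close k a u := by
  rw [h.adj' a (hA.lt a ha) u hu, and_iff_right]
  rintro rfl
  exact hux (hA.mem a ha)

theorem distinguished_of_spread (h : Linked G k l e e' z)
    (hA : Spread k (k * k) (fun p => τ (e' p) < τ x) A) {a b : ℕ} (ha : a ∈ A) (hb : b ∈ A)
    (hab : a ≠ b) : Distinguished G τ x (e' a) (e' b) := by
  wlog hlt : a < b generalizing a b
  · exact (this hb ha hab.symm (by omega)).symm
  obtain ⟨u, hu, hux, hsep⟩ := hA.separated a ha b hb hlt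
  refine ⟨e' u, not_lt.1 hux, ?_⟩
  rwa [h.adj_iff_close_of_spread hA ha hu hux, h.adj_iff_close_of_spread hA hb hu hux]

theorem distinguished_of_forall_not_adj (h : Linked G k l e e' z)
    (hA : Spread k (k * k) (fun p => τ (e' p) < τ x) A) {a : ℕ} (ha : a ∈ A) {b : V}
    (hb : ∀ u, u + 1 < k * k → ¬ G.Adj b (e' u)) : Distinguished G τ x (e' a) b := by
  obtain ⟨u, hu, hux, hclose⟩ := hA.exists_close a ha
  exact ⟨e' u, not_lt.1 hux, fun hab =>
    hb u hu (hab.1 ((h.adj_iff_close_of_spread hA ha (by omega) hux).2 hclose))⟩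

theorem card_add_card_le (h : Linked G k l e e' z) (hτ : NarrowOrder G τ (k + 1))
    (hx : ∀ y, ¬ Shares G τ x y) (hA : Spread k (k * k) (fun p => τ (e' p) < τ x) A)
    {B : Finset V} (hB : ∀ b ∈ B, τ b < τ x) (hBe : ∀ b ∈ B, ∀ p < k * k, b ≠ e' p)
    (hBB : ∀ a ∈ B, ∀ b ∈ B, a ≠ b → Distinguished G τ x a b) : A.card + B.card ≤ k := by
  classical
  have hAB : ∀ a ∈ A, ∀ b ∈ B, Distinguished G τ x (e' a) b := fun a ha b hb =>
    h.distinguished_of_forall_not_adj hA ha fun u hu =>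
      h.not_adj_of_ne (hBe b hb) (by omega) (Or.inr hu)
  have hdisj : Disjoint (A.image e') B := Finset.disjoint_left.2
    (Finset.forall_mem_image.2 fun a ha hb => hBe _ hb a (hA.lt a ha) rfl)
  have hcard := hτ x hx (A.image e' ∪ B) ?_ ?_
  · rw [Finset.card_union_of_disjoint hdisj, Finset.card_image_of_injOn fun a ha b hb hab =>
      h.inj' a (hA.lt a ha) b (hA.lt b hb) hab] at hcard
    omega
  · intro a ha
    rcases Finset.mem_union.1 ha with ha | ha
    · obtain ⟨a, haA, rfl⟩ := Finset.mem_image.1 ha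
      exact hA.mem a haA
    · exact hB a ha
  · intro a ha b hb hab
    rcases Finset.mem_union.1 ha with ha | ha <;> rcases Finset.mem_union.1 hb with hb | hb
    · obtain ⟨a, haA, rfl⟩ := Finset.mem_image.1 ha
      obtain ⟨b, hbA, rfl⟩ := Finset.mem_image.1 hb
      exact h.distinguished_of_spread hA haA hbA (ne_of_apply_ne e' hab)
    · obtain ⟨a, haA, rfl⟩ := Finset.mem_image.1 ha
      exact hAB a haA b hb
    · obtain ⟨b, hbA, rfl⟩ := Finset.mem_image.1 hb
      exact (hAB b hbA a ha).symm
    · exact hBB a ha b hb hab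

end Spread

section MissingClass

variable {x : ℕ}

theorem not_distinguished (h : Linked G k l e e' z) (hk : 3 ≤ k) (hτ : Function.Injective τ)
    (hnarrow : NarrowOrder G τ (k + 1)) (hx : MissingClass k (fun p => τ (e' p)) c x) {a b : V}
    (ha : τ a < τ (e' x)) (hae : ∀ p < k * k, a ≠ e' p) (hb : τ b < τ (e' x))
    (hbe : ∀ p < k * k, b ≠ e' p) : ¬ Distinguished G τ (e' x) a b := by
  classical
  intro hab
  obtain ⟨A, hcard, hA⟩ := hx.exists_spread hk
  have := h.card_add_card_le hnarrow (h.not_shares hk hτ hx) hA (B := {a, b})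
    (by simp [ha, hb]) (by simpa using ⟨hae, hbe⟩) (by simp [hab, hab.symm])
  rw [Finset.card_pair hab.ne, hcard] at this
  omega

theorem le_last (h : Linked G k l e e' z) (hk : 3 ≤ k) (hτ : Function.Injective τ)
    (hnarrow : NarrowOrder G τ (k + 1))
    (hx : MissingClass k (fun p => τ (e' p)) (x % k) x) {b : V} (hb : τ b < τ (e' x))
    (hbe : ∀ p < k * k, b ≠ e' p) : τ (e' x) ≤ τ (e' (k * k - 1)) := by
  by_contra! hlast
  obtain ⟨c, w, hw, hxw, A, hcard, hA⟩ := hx.exists_spread_of_last_lt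
    (fun p hp q hq hpq => h.inj' p hp q hq (hτ hpq)) hk hlast
  have := h.card_add_card_le hnarrow (h.not_shares hk hτ hw) hA (B := {b})
    (by simpa using hb.trans_le hxw) (by simpa using hbe) (by simp)
  rw [Finset.card_singleton, hcard] at this
  omega

theorem le_path (h : Linked G k l e e' z) (hk : 3 ≤ k) (hτ : Function.Injective τ)
    (hnarrow : NarrowOrder G τ (k + 1))
    (hx : MissingClass k (fun p => τ (e' p)) (x % k) x) {b : V} (hb : τ b < τ (e' x))
    (hbe : ∀ p < k * k, b ≠ e' p) (hbz : b ≠ z l) : τ (e' x) ≤ τ (z l) := by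
  by_contra! hz
  have hkk : 0 < k * k := Nat.mul_pos (by omega) (by omega)
  refine h.not_distinguished hk hτ hnarrow hx hb hbe hz (fun p => h.path_ne le_rfl)
    ⟨_, h.le_last hk hτ hnarrow hx hb hbe, fun hadj => ?_⟩
  exact h.not_adj_of_ne hbe (by omega) (Or.inl hbz) (hadj.2 h.adj_path_last)

theorem exists_path_lt_le (h : Linked G k l e e' z) {t : ℕ} (hlast : τ (e (k * k - 1)) < t)
    (hz : t ≤ τ (z l)) : ∃ i < l, τ (z i) < t ∧ t ≤ τ (z (i + 1)) := by
  by_contra! hstep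
  have : ∀ i ≤ l, τ (z i) < t := by
    intro i
    induction i with
    | zero => exact fun _ => h.first ▸ hlast
    | succ i ih => exact fun hil => hstep i hil (ih (by omega))
  exact (this l le_rfl).not_ge hz

theorem contradiction_of_lt (h : Linked G k l e e' z) (hk : 3 ≤ k) (hτ : Function.Injective τ)
    (hnarrow : NarrowOrder G τ (k + 1)) {y : ℕ} (hy : MissingClass k (fun p => τ (e p)) c y)
    (hx : MissingClass k (fun p => τ (e' p)) (x % k) x) (hyx : τ (e y) < τ (e' x)) : False := by
  obtain ⟨a, b, hab, hb, hay, hby⟩ := hy.exists_pair hk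
  have hax := hay.trans hyx
  have hae := h.disjoint a (by omega)
  have not_distinguished {u v : V} := h.not_distinguished hk hτ hnarrow hx (a := u) (b := v)
  have out_a : ∀ v, G.Adj (e a) v → ∃ q < k * k, v = e q := fun v hv =>
    (h.out a (by omega) v hv).resolve_right fun hlast => by omega
  have haz : e a ≠ z l := fun heq => by
    obtain ⟨q, hq, hqe⟩ := out_a _ (heq ▸ h.adj_path_last)
    exact h.disjoint q hq _ (by omega) hqe.symm
  have hz := h.le_path hk hτ hnarrow hx hax hae haz
  by_cases hfull : ∀ u < k * k, τ (e u) < τ (e' x)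
  · obtain ⟨i, hi, hzi, hzi'⟩ := h.exists_path_lt_le (hfull _ (by omega)) hz
    refine not_distinguished hax hae hzi (fun p => h.path_ne hi.le) ⟨_, hzi', fun hadj => ?_⟩
    obtain ⟨q, hq, hqz⟩ := out_a _ (hadj.2 (h.adj_path i hi.le))
    exact hzi'.not_gt (hqz ▸ hfull q hq)
  · push Not at hfull
    obtain ⟨u, hu, hux⟩ := hfull
    obtain ⟨p, hp, q, hq, hpx, hqx, v, hv, hvx, hsep⟩ := exists_separated
      (T := fun p => τ (e p) < τ (e' x)) hk hax (hby.trans hyx) hab hb hu hux.not_gt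
    refine not_distinguished hpx (h.disjoint p hp) hqx (h.disjoint q hq) ⟨e v, not_lt.1 hvx, ?_⟩
    have hpv : p ≠ v := fun hpv => hvx (hpv ▸ hpx)
    have hqv : q ≠ v := fun hqv => hvx (hqv ▸ hqx)
    rwa [h.adj p hp v hv, h.adj q hq v hv, and_iff_right hpv, and_iff_right hqv]

theorem lt_lcwd (h : Linked G k l e e' z) (hk : 3 ≤ k) : ((k + 1 : ℕ) : ℕ∞) < lcwd G := by
  by_contra! hle
  obtain ⟨τ, hτ, hnarrow⟩ := exists_narrowOrder_of_lcwd_le hle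
  obtain ⟨x, hx⟩ := exists_missingClass (k := k) (f := fun p => τ (e p)) (by omega)
    fun p hp q hq hpq => h.inj p hp q hq (hτ hpq)
  obtain ⟨y, hy⟩ := exists_missingClass (k := k) (f := fun p => τ (e' p)) (by omega)
    fun p hp q hq hpq => h.inj' p hp q hq (hτ hpq)
  rcases lt_trichotomy (τ (e x)) (τ (e' y)) with hlt | heq | hlt
  · exact h.contradiction_of_lt hk hτ hnarrow hx hy hlt
  · exact h.disjoint x hx.lt y hy.lt (hτ heq)
  · exact h.symm.contradiction_of_lt hk hτ hnarrow hy hx hlt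

end MissingClass

end Linked

end LowerBound

theorem lcwd_induce_MGraph_le {k l : ℕ} (hk : 3 ≤ k)
    {s : Set (Fin (k ^ 2) ⊕ (Fin (k ^ 2) ⊕ Fin l))} (hs : s ≠ Set.univ) :
    lcwd ((MGraph k l).induce s) ≤ ((k + 1 : ℕ) : ℕ∞) :=
  haveI : NeZero k := ⟨by omega⟩
  (linked_MGraph k l).lcwd_induce_le hk hs

theorem lt_lcwd_MGraph {k l : ℕ} (hk : 3 ≤ k) : ((k + 1 : ℕ) : ℕ∞) < lcwd (MGraph k l) :=
  haveI : NeZero k := ⟨by omega⟩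
  (linked_MGraph k l).lt_lcwd hk

section Orders

variable {V : Type*} {G : SimpleGraph V} [DecidableRel G.Adj] {k : ℕ}

/-- The neighbourhoods in `R` of the vertices in `T`, without repetitions. -/
def traces (G : SimpleGraph V) [DecidableRel G.Adj] (T R : List V) : List (List Bool) :=
  (T.map fun y => R.map fun u => decide (G.Adj y u)).dedup

/-- When the vertices in `R` are added one by one to those in `T`, the vertices that were added
before always have at most `k` neighbourhoods among the others. This is a decidable form of
`NarrowPrefix`. -/
def FewTraces (G : SimpleGraph V) [DecidableRel G.Adj] (k : ℕ) : List V → List V → Prop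
  | _, [] => True
  | T, x :: R => (traces G T (x :: R)).length ≤ k ∧ FewTraces G k (x :: T) R

instance FewTraces.decidable (k : ℕ) : ∀ T R : List V, Decidable (FewTraces G k T R)
  | _, [] => inferInstanceAs (Decidable True)
  | T, x :: R =>
    have := FewTraces.decidable k (x :: T) R
    inferInstanceAs (Decidable ((traces G T (x :: R)).length ≤ k ∧ FewTraces G k (x :: T) R))

theorem fewGroups_of_length_traces_le {T R : List V} (h : (traces G T R).length ≤ k) :
    FewGroups k G {v | v ∈ T ∨ v ∈ R} {v | v ∈ T} := by
  let trace : V → List Bool := fun y => R.map fun u => decide (G.Adj y u)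
  have mem_traces : ∀ y ∈ T, trace y ∈ traces G T R := fun y hy =>
    List.mem_dedup.2 (List.mem_map_of_mem hy)
  refine ⟨fun y => (traces G T R).idxOf (trace y),
    fun y hy => (List.idxOf_lt_length_of_mem (mem_traces y hy)).trans_le h,
    fun y hy y' _ hyy' u hu huT hadj => ?_⟩
  have htrace : trace y = trace y' := (List.idxOf_inj (mem_traces y hy)).1 hyy'
  have := List.map_inj_left.1 htrace u (hu.resolve_left huT)
  simpa [hadj] using this

theorem FewTraces.narrowPrefix : ∀ {T R : List V}, FewTraces G k T R →
    NarrowPrefix k G {v | v ∈ T ∨ v ∈ R} {v | v ∈ T} →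
    NarrowPrefix k G {v | v ∈ T ∨ v ∈ R} {v | v ∈ T ∨ v ∈ R}
  | T, [], _, h => by simpa using h
  | T, x :: R, hfew, h => by
    have h' := h.add (fewGroups_of_length_traces_le hfew.1) (x := x) (Or.inr List.mem_cons_self)
    have hW : {v | v ∈ T ∨ v ∈ x :: R} = {v | v ∈ x :: T ∨ v ∈ R} := by
      ext v
      simp only [Set.mem_ofPred_eq, List.mem_cons]
      tauto
    have hT : insert x {v | v ∈ T} = {v | v ∈ x :: T} := by
      ext v
      simp
    rw [hW, hT] at h'
    rw [hW]
    exact FewTraces.narrowPrefix hfew.2 h'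

theorem lcwd_induce_le_of_fewTraces
    (h : ∀ d, ∃ R : List V, FewTraces G k [] R ∧ ∀ v ≠ d, v ∈ R) {s : Set V}
    (hs : s ≠ Set.univ) : lcwd (G.induce s) ≤ ((k + 1 : ℕ) : ℕ∞) := by
  obtain ⟨d, hd⟩ := (Set.ne_univ_iff_exists_notMem s).1 hs
  obtain ⟨R, hfew, hR⟩ := h d
  have hnarrow := hfew.narrowPrefix (by simpa using NarrowPrefix.empty)
  exact lcwd_le (hnarrow.hasLinearExpr fun v hv =>
    Or.inr (hR v fun hvd => hd (hvd ▸ hv)))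

end Orders

section Gems

instance : DecidableRel gem.Adj :=
  inferInstanceAs (DecidableRel (SimpleGraph.fromRel _).Adj)

instance : DecidableRel MMinusTwo.Adj
  | Sum.inl p, Sum.inl q => inferInstanceAs (Decidable (gem.Adj p q))
  | Sum.inr p, Sum.inr q => inferInstanceAs (Decidable (gem.Adj p q))
  | Sum.inl _, Sum.inr _ => isFalse (by simp [MMinusTwo])
  | Sum.inr _, Sum.inl _ => isFalse (by simp [MMinusTwo])

theorem MPlusTwo_adj {p q : Fin 5 ⊕ Fin 5} : MPlusTwo.Adj p q ↔
    MMinusTwo.Adj p q ∨ p = Sum.inl 3 ∧ q = Sum.inr 3 ∨ p = Sum.inr 3 ∧ q = Sum.inl 3 := by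
  rw [MPlusTwo, SimpleGraph.sup_adj, SimpleGraph.edge_adj]
  grind

instance : DecidableRel MPlusTwo.Adj := fun _ _ => decidable_of_iff _ MPlusTwo_adj.symm

/-- An order of all vertices of two gems but `d`: first the gem without `d`, then the other
vertices of the gem with `d`, in the order `p`. -/
def gemOrder (p : Fin 5 → List (Fin 5)) : Fin 5 ⊕ Fin 5 → List (Fin 5 ⊕ Fin 5)
  | Sum.inl d => (List.finRange 5).map Sum.inr ++ (p d).map Sum.inl
  | Sum.inr d => (List.finRange 5).map Sum.inl ++ (p d).map Sum.inr

theorem mem_gemOrder {p : Fin 5 → List (Fin 5)} (hp : ∀ d, ∀ q ≠ d, q ∈ p d) :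
    ∀ d, ∀ v ≠ d, v ∈ gemOrder p d
  | Sum.inl d, Sum.inl q, hq => by simpa [gemOrder] using hp d q fun hqd => hq (hqd ▸ rfl)
  | Sum.inl d, Sum.inr q, _ => by simp [gemOrder]
  | Sum.inr d, Sum.inl q, _ => by simp [gemOrder]
  | Sum.inr d, Sum.inr q, hq => by simpa [gemOrder] using hp d q fun hqd => hq (hqd ▸ rfl)

theorem lcwd_induce_MPlusTwo_le {s : Set (Fin 5 ⊕ Fin 5)} (hs : s ≠ Set.univ) :
    lcwd (MPlusTwo.induce s) ≤ 3 :=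
  let p := ![[3, 1, 2, 4], [3, 2, 0, 4], [3, 4, 0, 1], [0, 2, 1, 4], [3, 2, 0, 1]]
  have hfew : ∀ d, FewTraces MPlusTwo 2 [] (gemOrder p d) := by decide +kernel
  lcwd_induce_le_of_fewTraces (k := 2)
    (fun d => ⟨gemOrder p d, hfew d, mem_gemOrder (by decide +kernel) d⟩) hs

theorem lcwd_induce_MMinusTwo_le {s : Set (Fin 5 ⊕ Fin 5)} (hs : s ≠ Set.univ) :
    lcwd (MMinusTwo.induce s) ≤ 3 :=
  let p := ![[1, 3, 2, 4], [0, 4, 2, 3], [0, 1, 3, 4], [0, 2, 1, 4], [0, 1, 2, 3]]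
  have hfew : ∀ d, FewTraces MMinusTwo 2 [] (gemOrder p d) := by decide +kernel
  lcwd_induce_le_of_fewTraces (k := 2)
    (fun d => ⟨gemOrder p d, hfew d, mem_gemOrder (by decide +kernel) d⟩) hs

/-- When the vertices of a gem are added in the order `f`, the vertex `x` cannot share the label of
a vertex present, and two vertices present have different nonempty neighbourhoods among those not
yet present. Each of these two then needs a label of its own even if vertices without neighbours
in the gem are present too. -/
def Decisive (f : Fin 5 → ℕ) (x : Fin 5) : Prop :=
  (∀ y, ¬ Shares gem f x y) ∧ ∃ a b, f a < f x ∧ f b < f x ∧ Distinguished gem f x a b ∧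
    (∃ u, f x ≤ f u ∧ gem.Adj a u) ∧ ∃ u, f x ≤ f u ∧ gem.Adj b u

instance (f : Fin 5 → ℕ) (x : Fin 5) : Decidable (Decisive f x) := by
  unfold Decisive Shares Distinguished
  infer_instance

theorem Decisive.congr {f g : Fin 5 → ℕ} {x : Fin 5} (h : Decisive f x)
    (hfg : ∀ a b, f a < f b ↔ g a < g b) : Decisive g x := by
  have hle : ∀ a b, f a ≤ f b ↔ g a ≤ g b := fun a b => by simpa using (hfg b a).not
  simpa only [Decisive, Shares, Distinguished, hfg, hle] using h

theorem exists_decisive_perm : ∀ σ : Equiv.Perm (Fin 5), ∃ x, Decisive (fun p => σ p) x := by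
  decide +kernel

theorem exists_decisive {f : Fin 5 → ℕ} (hf : Function.Injective f) : ∃ x, Decisive f x := by
  have hmono : StrictMono (f ∘ Tuple.sort f) :=
    (Tuple.monotone_sort f).strictMono_of_injective (hf.comp (Equiv.injective _))
  obtain ⟨x, hx⟩ := exists_decisive_perm (Tuple.sort f).symm
  refine ⟨x, hx.congr fun a b => ?_⟩
  rw [Fin.val_fin_lt, ← hmono.lt_iff_lt]
  simp only [Function.comp_apply, Equiv.apply_symm_apply]

variable {V : Type*} {G : SimpleGraph V} {e e' : Fin 5 → V} {τ : V → ℕ} {x x' : Fin 5}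

/-- `G` contains two disjoint induced gems `e` and `e'`, and the only other edge that leaves one of
them may be that between the vertices `e 3` and `e' 3`. -/
structure TwoGems (G : SimpleGraph V) (e e' : Fin 5 → V) : Prop where
  inj : Function.Injective e
  inj' : Function.Injective e'
  adj : ∀ p q, G.Adj (e p) (e q) ↔ gem.Adj p q
  adj' : ∀ p q, G.Adj (e' p) (e' q) ↔ gem.Adj p q
  disjoint : ∀ p q, e p ≠ e' q
  out : ∀ p v, G.Adj (e p) v → (∃ q, v = e q) ∨ p = 3 ∧ v = e' 3
  out' : ∀ p v, G.Adj (e' p) v → (∃ q, v = e' q) ∨ p = 3 ∧ v = e 3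

theorem exists_gem_adj_ne : ∀ x, ∃ u, gem.Adj x u ∧ u ≠ 3 := by
  decide +kernel

namespace TwoGems

theorem symm (h : TwoGems G e e') : TwoGems G e' e :=
  ⟨h.inj', h.inj, h.adj', h.adj, fun p q he => h.disjoint q p he.symm, h.out', h.out⟩

theorem not_shares (h : TwoGems G e e') (hx : ∀ q, ¬ Shares gem (fun p => τ (e' p)) x q) (y : V) :
    ¬ Shares G τ (e' x) y := by
  rintro ⟨hlt, hnadj, hsub, hsup⟩
  obtain ⟨u, hxu, hu⟩ := exists_gem_adj_ne x
  obtain ⟨q, rfl⟩ : ∃ q, y = e' q :=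
    (h.out' u y (hsub _ ((h.adj' x u).2 hxu)).symm).resolve_right fun hu' => hu hu'.1
  exact hx q ⟨hlt, fun hadj => hnadj ((h.adj' x q).2 hadj),
    fun z hz => (h.adj' q z).1 (hsub _ ((h.adj' x z).2 hz)),
    fun z hxz hz => (h.adj' x z).1 (hsup _ hxz ((h.adj' q z).2 hz))⟩

theorem distinguished_of_adj (h : TwoGems G e e') {a y : Fin 5} (hy : y ≠ 3)
    (ha : ∃ u, τ (e' x) ≤ τ (e' u) ∧ gem.Adj a u) : Distinguished G τ (e' x) (e' a) (e y) := by
  obtain ⟨u, hu, hau⟩ := ha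
  refine ⟨e' u, hu, fun hadj => ?_⟩
  rcases h.out y _ (hadj.1 ((h.adj' a u).2 hau)) with ⟨q, hq⟩ | ⟨hy3, -⟩
  · exact h.disjoint q u hq.symm
  · exact hy hy3

theorem contradiction_of_lt (h : TwoGems G e e') (hnarrow : NarrowOrder G τ 3)
    (hx : Decisive (fun p => τ (e p)) x) (hx' : Decisive (fun p => τ (e' p)) x')
    (hlt : τ (e x) < τ (e' x')) : False := by
  classical
  obtain ⟨y, hy, hy3⟩ : ∃ y, τ (e y) < τ (e' x') ∧ y ≠ 3 := by
    obtain ⟨-, a, b, ha, hb, hab, -⟩ := hx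
    by_cases ha3 : a = 3
    · exact ⟨b, hb.trans hlt, fun hb3 => hab.ne (ha3.trans hb3.symm)⟩
    · exact ⟨a, ha.trans hlt, ha3⟩
  obtain ⟨hshares, a, b, ha, hb, ⟨u, hu, hu'⟩, ha', hb'⟩ := hx'
  have hab : Distinguished G τ (e' x') (e' a) (e' b) := ⟨e' u, hu, by rwa [h.adj', h.adj']⟩
  have hay := h.distinguished_of_adj hy3 ha'
  have hby := h.distinguished_of_adj hy3 hb'
  have := hnarrow _ (h.not_shares hshares) {e' a, e' b, e y} (by simpa using ⟨ha, hb, hy⟩)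
    (by simp [hab, hab.symm, hay, hay.symm, hby, hby.symm])
  rw [Finset.card_eq_three.2 ⟨_, _, _, hab.ne, hay.ne, hby.ne, rfl⟩] at this
  omega

theorem three_lt_lcwd (h : TwoGems G e e') : 3 < lcwd G := by
  by_contra! hle
  obtain ⟨τ, hτ, hnarrow⟩ := exists_narrowOrder_of_lcwd_le (k := 3) hle
  obtain ⟨x, hx⟩ := exists_decisive (hτ.comp h.inj)
  obtain ⟨x', hx'⟩ := exists_decisive (hτ.comp h.inj')
  rcases lt_trichotomy (τ (e x)) (τ (e' x')) with hlt | heq | hlt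
  · exact h.contradiction_of_lt hnarrow hx hx' hlt
  · exact h.disjoint x x' (hτ heq)
  · exact h.symm.contradiction_of_lt hnarrow hx' hx hlt

end TwoGems

theorem twoGems_MPlusTwo : TwoGems MPlusTwo Sum.inl Sum.inr :=
  ⟨Sum.inl_injective, Sum.inr_injective, by decide +kernel, by decide +kernel,
    fun _ _ => Sum.inl_ne_inr, by decide +kernel, by decide +kernel⟩

theorem twoGems_MMinusTwo : TwoGems MMinusTwo Sum.inl Sum.inr :=
  ⟨Sum.inl_injective, Sum.inr_injective, by decide +kernel, by decide +kernel,
    fun _ _ => Sum.inl_ne_inr, by decide +kernel, by decide +kernel⟩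

end Gems

end LinCW

theorem mainTheorem3 :
    (∀ s : Set (Fin 5 ⊕ Fin 5), s ≠ Set.univ → LinCW.lcwd (LinCW.MPlusTwo.induce s) ≤ 3) ∧
    (∀ s : Set (Fin 5 ⊕ Fin 5), s ≠ Set.univ → LinCW.lcwd (LinCW.MMinusTwo.induce s) ≤ 3) ∧
    (∀ k l : ℕ, 3 ≤ k → ∀ s : Set (Fin (k ^ 2) ⊕ (Fin (k ^ 2) ⊕ Fin l)), s ≠ Set.univ →
      LinCW.lcwd ((LinCW.MGraph k l).induce s) ≤ ((k + 1 : ℕ) : ℕ∞)) ∧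
    3 < LinCW.lcwd LinCW.MPlusTwo ∧
    3 < LinCW.lcwd LinCW.MMinusTwo ∧
    (∀ k l : ℕ, 3 ≤ k → ((k + 1 : ℕ) : ℕ∞) < LinCW.lcwd (LinCW.MGraph k l)) :=
  ⟨fun _ => LinCW.lcwd_induce_MPlusTwo_le, fun _ => LinCW.lcwd_induce_MMinusTwo_le,
    fun _ _ hk _ => LinCW.lcwd_induce_MGraph_le hk, LinCW.twoGems_MPlusTwo.three_lt_lcwd,
    LinCW.twoGems_MMinusTwo.three_lt_lcwd, fun _ _ => LinCW.lt_lcwd_MGraph⟩
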